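/- Let $\mathcal T=(V,E)$ be a directed tree, i.e. a connected directed graph without loops and circuits in which every vertex $v$ has at most one parent $\mathrm{Par}(v)$; a root is a vertex without a parent. Let $\mathrm{Chi}(u)$ be the set of children of $u$, $\mathrm{Chi}^n(u)$ the set of its $n$-th generation descendants, and $\mathrm{Gen}(u)$ the level of $u$ (all $v$ that have a common $j$-th ancestor with $u$ for some $j\ge 0$). Let $\lambda_v>0$ be weights ($v\in V$ not a root) with $\sup_u\sum_{v\in\mathrm{Chi}(u)}\lambda_v^2<\infty$, and let $S_\lambda$ be the bounded operator on $\ell^2(V)$ with $S_\lambda e_u=\sum_{v\in \mathrm{Chi}(u)}\lambda_v e_v$. Assume that $S_\lambda$ is a contraction and is not stable, i.e. the stable subspace $\mathcal H_0=\{h:\ \|S_\lambda^n h\|\to 0\}$ is not all of $\ell^2(V)$. Let $A=\lim_n S_\lambda^{*n}S_\lambda^n$ (strong limit) be the asymptotic limit, and let $U$ be the isometric asymptote of $S_\lambda$: the unique isometry on $\overline{\operatorname{ran}A}=\mathcal H_0^\perp$ with $A^{1/2}S_\lambda=UA^{1/2}$. Put $$\alpha_u=\lim_{n\to\infty}\ \sum_{v\in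 \mathrm{Chi}^n(u)}\ \prod_{j=0}^{n-1}\lambda_{\mathrm{Par}^j(v)}^2 .$$ Then these limits exist, and there is a (unique) set $V'\subseteq V$ with $\mathcal H_0=\ell^2(V\setminus V')$ and $\mathcal H_0^\perp=\ell^2(V')$. The subgraph $\mathcal T'=(V',E\cap(V'\times V'))$ is a leafless directed tree, $\alpha_{v'}>0$ for $v'\in V'$, and $V'$ contains the parent of each of its vertices that has one. The isometric asymptote $U$ on $\mathcal H_0^\perp=\ell^2(V')$ is the weighted shift on $\mathcal T'$ with weights $$\beta_{v'}=\frac{\lambda_{v'}\sqrt{\alpha_{v'}}}{\sqrt{\alpha_{\mathrm{Par}(v')}}}\qquad (v'\in V' \text{ not the root of } \mathcal T').$$ Let $S^+$ and $S$ be the simple unilateral and bilateral shifts on $\ell^2(\mathbb Z_+)$ and $\ell^2(\mathbb Z)$, and let $\mathrm{Br}(\mathcal T')=\sum(|\mathrm{Chi}_{\mathcal T'}(u)|-1)\in\{0,1,\dots,\infty\}$, the sum being over the vertices $u$ of $\mathcal T'$ with more than one child in $\mathcal T'$ (multiplicity $\infty$ means countably infinitely many copies). Then: (i) if $\mathcal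 T$ has a root, $U$ is unitarily equivalent to the orthogonal sum of $\mathrm{Br}(\mathcal T')+1$ copies of $S^+$; (ii) if $\mathcal T$ has no root and $U$ is completely non-unitary (the only reducing subspace on which it is unitary is $\{0\}$), $U$ is unitarily equivalent to the orthogonal sum of $\mathrm{Br}(\mathcal T')$ copies of $S^+$; (iii) if $\mathcal T$ has no root and $U$ is not completely non-unitary, $U$ is unitarily equivalent to the orthogonal sum of $S$ and $\mathrm{Br}(\mathcal T')$ copies of $S^+$. Moreover, if $\mathcal T$ has no root, then $U$ is completely non-unitary if and only if $\sum_{v'\in\mathrm{Gen}_{\mathcal T'}(u')}\prod_{j=0}^\infty\beta_{\mathrm{Par}^j(v')}^2=0$ for some $u'\in V'$, and also if and only if this holds for every $u'\in V'$. -/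

import Mathlib

open Filter Topology
open scoped ENNReal

noncomputable section

namespace TreeShift

/-! ### Directed trees -/

section Graph

variable {V : Type*} (G : Digraph V)

/-- A directed tree: a connected directed graph in which every vertex has at most one parent and
which has no circuit. (No closed directed walk of positive length: no loops and no circuits.) -/
structure IsDirectedTree : Prop where
  connected : ∀ u v, Relation.ReflTransGen (fun a b => G.Adj a b ∨ G.Adj b a) u v
  parent_unique : ∀ u u' v, G.Adj u v → G.Adj u' v → u = u'
  acyclic : ∀ v, ¬ Relation.TransGen G.Adj v v

/-- The set of children of a vertex. -/
def chi (u : V) : Set V := {v | G.Adj u v}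

/-- The children of a set of vertices. -/
def chiSet (W : Set V) : Set V := ⋃ v ∈ W, chi G v

/-- The set of `n`-th generation descendants of `u`. -/
def chiPow (n : ℕ) (u : V) : Set V := (chiSet G)^[n] {u}

/-- `v` is a root if it is not a child of any vertex. -/
def IsRoot (v : V) : Prop := ∀ u, ¬ G.Adj u v

/-- The graph has a root. -/
def HasRoot : Prop := ∃ r, IsRoot G r

/-- Every vertex has a child. -/
def IsLeafless : Prop := ∀ u, (chi G u).Nonempty

open Classical in
/-- The parent of a vertex; for a root, which has no parent, the value is the root itself
and is irrelevant. -/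
def par (v : V) : V := if h : ∃ u, G.Adj u v then h.choose else v

/-- The whole generation (level) of `u`: those `v` that are reached from some `j`-th ancestor `w`
of `u` by going down `j` levels. -/
def gen (u : V) : Set V := {v | ∃ j w, u ∈ chiPow G j w ∧ v ∈ chiPow G j w}

/-- The branching index: the sum of `|chi u| - 1` over all branching vertices `u`, as an
extended natural number (the sum being the supremum of the finite partial sums). -/
def branchingIndex : ℕ∞ :=
  ⨆ s : Finset {u : V // 1 < (chi G u).encard}, ∑ u ∈ s, ((chi G u.1).encard - 1)

/-- The subgraph on the vertex set `W` with all edges between vertices of `W`. -/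
def inducedGraph (W : Set V) : Digraph W where
  Adj u v := G.Adj u.1 v.1

variable {G} in
lemma par_eq {u v : V} (hG : ∀ u u' v, G.Adj u v → G.Adj u' v → u = u') (h : G.Adj u v) :
    par G v = u := by
  have h' : ∃ u, G.Adj u v := ⟨u, h⟩
  rw [par, dif_pos h']
  exact hG _ _ _ h'.choose_spec h

lemma adj_par {v : V} (h : ∃ u, G.Adj u v) : G.Adj (par G v) v := by
  rw [par, dif_pos h]; exact h.choose_spec

end Graph

/-! ### The space of square summable functions -/

/-- The complex Hilbert space of square summable functions on `ι`. -/
abbrev Ell2 (ι : Type*) : Type _ := lp (fun _ : ι => ℂ) 2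

open Classical in
/-- The vectors of the standard orthonormal basis. -/
def basisVec {ι : Type*} (i : ι) : Ell2 ι := lp.single 2 i 1

/-- The closed subspace spanned by the `basisVec w` with `w ∈ W`. -/
def ell2Sub {ι : Type*} (W : Set ι) : Submodule ℂ (Ell2 ι) :=
  (Submodule.span ℂ (basisVec '' W)).topologicalClosure

lemma extend_norm_sq {ι κ : Type*} (φ : ι → κ) (hφ : Function.Injective φ) (f : ι → ℂ) :
    (fun k => ‖Function.extend φ f 0 k‖ ^ (2 : ℝ≥0∞).toReal) =
      Function.extend φ (fun i => ‖f i‖ ^ (2 : ℝ≥0∞).toReal) 0 := by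
  funext k
  by_cases h : ∃ i, φ i = k
  · obtain ⟨i, rfl⟩ := h
    simp [hφ.extend_apply]
  · simp [Function.extend_apply' _ _ _ h]

/-- The isometry `basisVec i ↦ basisVec (φ i)` induced by an injective map `φ`:
`f` is transported along `φ` and extended by zero. -/
def ell2Map {ι κ : Type*} (φ : ι → κ) (hφ : Function.Injective φ) : Ell2 ι →ₗᵢ[ℂ] Ell2 κ where
  toFun f := ⟨Function.extend φ f 0, by
    apply memℓp_gen
    rw [extend_norm_sq φ hφ]
    exact (summable_extend_zero hφ).2 ((lp.memℓp f).summable (by norm_num))⟩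
  map_add' f g := by
    ext k
    change Function.extend φ (⇑f + ⇑g) 0 k =
      Function.extend φ (⇑f) 0 k + Function.extend φ (⇑g) 0 k
    by_cases h : ∃ i, φ i = k
    · obtain ⟨i, rfl⟩ := h
      simp [hφ.extend_apply]
    · simp [Function.extend_apply' _ _ _ h]
  map_smul' c f := by
    ext k
    by_cases h : ∃ i, φ i = k
    · obtain ⟨i, rfl⟩ := h
      simp [hφ.extend_apply]
    · simp [Function.extend_apply' _ _ _ h]
  norm_map' f := by
    have h2 : 0 < (2 : ℝ≥0∞).toReal := by norm_num
    rw [lp.norm_eq_tsum_rpow h2, lp.norm_eq_tsum_rpow h2]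
    congr 1
    exact (congrArg tsum (extend_norm_sq φ hφ f)).trans (tsum_extend_zero hφ _)

lemma ell2Map_apply {ι κ : Type*} (φ : ι → κ) (hφ : Function.Injective φ) (f : Ell2 ι) (i : ι) :
    ell2Map φ hφ f (φ i) = f i := hφ.extend_apply _ _ _

lemma ell2Map_apply_of_notMem {ι κ : Type*} (φ : ι → κ) (hφ : Function.Injective φ) (f : Ell2 ι)
    (k : κ) (hk : ¬ ∃ i, φ i = k) : ell2Map φ hφ f k = 0 := Function.extend_apply' _ _ _ hk

/-- The inclusion of the square summable functions on a subset `W`: extension by zero. -/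
def ell2Incl {ι : Type*} (W : Set ι) : Ell2 W →ₗᵢ[ℂ] Ell2 ι :=
  ell2Map Subtype.val Subtype.val_injective

/-! ### Weighted shifts on directed trees -/

section Shift

variable {V : Type*} (G : Digraph V)

/-- The boundedness condition `sup_u √(∑_{v ∈ chi u} |lam v|²) < ∞` on the weights. Only the
weights of the vertices that are not roots enter. -/
def BoundedWeights (lam : V → ℝ) : Prop :=
  (∀ u, Summable fun v : chi G u => |lam v| ^ 2) ∧
    BddAbove (Set.range fun u => √(∑' v : chi G u, |lam v| ^ 2))

open Classical in
/-- Coordinates of the weighted shift: the value at `v` is `lam v * f (par v)` if `v` has a parent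
and `0` if `v` is a root. -/
def shiftFun (lam : V → ℝ) (f : V → ℂ) (v : V) : ℂ :=
  if ∃ u, G.Adj u v then (lam v : ℂ) * f (par G v) else 0

variable {G} in
open Classical in
lemma shiftFun_bound {lam : V → ℝ} (h : BoundedWeights G lam) :
    ∃ C : ℝ, 0 ≤ C ∧ ∀ (f : Ell2 V) (s : Finset V),
      ∑ v ∈ s, ‖shiftFun G lam f v‖ ^ (2 : ℝ≥0∞).toReal ≤
        (C * ‖f‖) ^ (2 : ℝ≥0∞).toReal := by
  obtain ⟨hs, C, hC⟩ := h
  have hC' : ∀ u, √(∑' v : chi G u, |lam v| ^ 2) ≤ C := fun u => hC ⟨u, rfl⟩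
  have h2 : (2 : ℝ≥0∞).toReal = (2 : ℕ) := by norm_num
  refine ⟨max C 0, le_max_right _ _, fun f s => ?_⟩
  have hnorm : ∀ t : Finset V, ∑ u ∈ t, ‖f u‖ ^ 2 ≤ ‖f‖ ^ 2 := fun t => by
    have := lp.sum_rpow_le_norm_rpow (p := 2) (by norm_num) f t
    simpa [h2, Real.rpow_natCast] using this
  simp only [h2, Real.rpow_natCast]
  have hfib : ∀ u, ∑ v ∈ s with par G v = u, ‖shiftFun G lam f v‖ ^ 2 ≤
      (max C 0) ^ 2 * ‖f u‖ ^ 2 := by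
    intro u
    have h1 : ∑ v ∈ s with par G v = u, ‖shiftFun G lam f v‖ ^ 2 ≤
        ∑ v ∈ s with v ∈ chi G u, |lam v| ^ 2 * ‖f u‖ ^ 2 := by
      have : ∀ v ∈ s.filter (fun v => par G v = u), v ∉ s.filter (fun v => v ∈ chi G u) →
          ‖shiftFun G lam f v‖ ^ 2 = 0 := by
        intro v hv hv'
        simp only [Finset.mem_filter, not_and] at hv hv'
        have : ¬ ∃ w, G.Adj w v := by
          intro hw
          apply hv' hv.1
          have := adj_par G hw
          rw [hv.2] at this
          exact this
        simp [shiftFun, this]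
      calc ∑ v ∈ s with par G v = u, ‖shiftFun G lam f v‖ ^ 2
          = ∑ v ∈ s.filter (fun v => par G v = u) with v ∈ chi G u,
              ‖shiftFun G lam f v‖ ^ 2 := by
            symm
            apply Finset.sum_subset (Finset.filter_subset _ _)
            intro v hv hv'
            apply this v hv
            intro hv''
            simp only [Finset.mem_filter] at hv hv' hv''
            exact hv' ⟨hv, hv''.2⟩
        _ ≤ ∑ v ∈ s.filter (fun v => par G v = u) with v ∈ chi G u, |lam v| ^ 2 * ‖f u‖ ^ 2 := by
            apply Finset.sum_le_sum
            intro v hv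
            simp only [Finset.mem_filter] at hv
            have hex : ∃ w, G.Adj w v := ⟨u, hv.2⟩
            rw [shiftFun, if_pos hex, hv.1.2, norm_mul, mul_pow, Complex.norm_real,
              Real.norm_eq_abs]
        _ ≤ _ := by
            apply Finset.sum_le_sum_of_subset_of_nonneg
            · intro v hv
              simp only [Finset.mem_filter] at hv ⊢
              exact ⟨hv.1.1, hv.2⟩
            · intros; positivity
    refine h1.trans ?_
    rw [← Finset.sum_mul]
    gcongr
    have h3 : ∑ v ∈ s with v ∈ chi G u, |lam v| ^ 2 ≤ ∑' v : chi G u, |lam v| ^ 2 := by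
      have := (hs u).sum_le_tsum (s.subtype (fun v => v ∈ chi G u)) (fun _ _ => by positivity)
      refine le_trans (le_of_eq ?_) this
      rw [Finset.sum_subtype_eq_sum_filter (f := fun v => |lam v| ^ 2)]
    refine h3.trans ?_
    have h4 : 0 ≤ ∑' v : chi G u, |lam v| ^ 2 := tsum_nonneg fun _ => by positivity
    calc _ = (√(∑' v : chi G u, |lam v| ^ 2)) ^ 2 := (Real.sq_sqrt h4).symm
      _ ≤ _ := by
        gcongr
        exact (hC' u).trans (le_max_left _ _)
  rw [← Finset.sum_fiberwise_of_maps_to (t := s.image (par G)) (g := par G)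
    (fun v hv => Finset.mem_image_of_mem _ hv)]
  calc _ ≤ ∑ u ∈ s.image (par G), (max C 0) ^ 2 * ‖f u‖ ^ 2 :=
        Finset.sum_le_sum fun u _ => hfib u
    _ = (max C 0) ^ 2 * ∑ u ∈ s.image (par G), ‖f u‖ ^ 2 := by rw [Finset.mul_sum]
    _ ≤ (max C 0) ^ 2 * ‖f‖ ^ 2 := by gcongr; exact hnorm _
    _ = _ := by ring

/-- The weighted shift as a linear map. -/
def shiftLin (lam : V → ℝ) (h : BoundedWeights G lam) : Ell2 V →ₗ[ℂ] Ell2 V where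
  toFun f := ⟨shiftFun G lam f, by
    obtain ⟨C, -, hC⟩ := shiftFun_bound h
    exact memℓp_gen' (hC f)⟩
  map_add' f g := by
    ext v
    change shiftFun G lam (⇑f + ⇑g) v = shiftFun G lam f v + shiftFun G lam g v
    by_cases hv : ∃ u, G.Adj u v
    · simp [shiftFun, hv, mul_add]
    · simp [shiftFun, hv]
  map_smul' c f := by
    ext v
    by_cases hv : ∃ u, G.Adj u v
    · simp [shiftFun, hv, mul_left_comm]
    · simp [shiftFun, hv]

/-- The weighted shift on `G` with weights `lam`: the bounded operator with
`basisVec u ↦ ∑_{v ∈ chi u} lam v • basisVec v` (see `hasSum_weightedShift_basisVec`). -/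
def weightedShift (lam : V → ℝ) (h : BoundedWeights G lam) : Ell2 V →L[ℂ] Ell2 V :=
  (shiftLin G lam h).mkContinuousOfExistsBound (by
    obtain ⟨C, hC0, hC⟩ := shiftFun_bound h
    exact ⟨C, fun f => lp.norm_le_of_forall_sum_le (by norm_num)
      (mul_nonneg hC0 (norm_nonneg f)) (hC f)⟩)

variable {G} in
lemma weightedShift_apply {lam : V → ℝ} (h : BoundedWeights G lam) (f : Ell2 V) :
    ⇑(weightedShift G lam h f) = shiftFun G lam f := rfl

variable {G} in
theorem hasSum_weightedShift_basisVec
    (hG : ∀ u u' v, G.Adj u v → G.Adj u' v → u = u')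
    {lam : V → ℝ} (h : BoundedWeights G lam) (u : V) :
    HasSum (fun v : chi G u => (lam v : ℂ) • basisVec v.1)
      (weightedShift G lam h (basisVec u)) := by
  classical
  have h1 := lp.hasSum_single (E := fun _ : V => ℂ) (p := 2) (by norm_num)
    (weightedShift G lam h (basisVec u))
  have h2 : ∀ v, weightedShift G lam h (basisVec u) v = if G.Adj u v then (lam v : ℂ) else 0 := by
    intro v
    rw [weightedShift_apply, shiftFun]
    by_cases huv : G.Adj u v
    · rw [if_pos ⟨u, huv⟩, if_pos huv, par_eq hG huv]
      simp [basisVec]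
    · rw [if_neg huv]
      split_ifs with hex
      · have : par G v ≠ u := by
          rintro rfl
          exact huv (adj_par G hex)
        simp [basisVec, this]
      · rfl
  have h3 := (hasSum_subtype_iff_of_support_subset (s := chi G u) (by
    intro v hv
    by_contra hv'
    apply hv
    change ¬ G.Adj u v at hv'
    simp only [h2, if_neg hv']
    exact map_zero (lp.singleAddMonoidHom (E := fun _ : V => ℂ) 2 v))).2 h1
  convert h3 using 1
  funext v
  have hv : G.Adj u v.1 := v.2
  rw [Function.comp_apply, h2, if_pos hv, basisVec, ← lp.single_smul]
  simp

/-- `alpha u = lim_n ∑_{v ∈ chiⁿ(u)} ∏_{j < n} lam (parʲ v)²`. -/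
def alphaSum (lam : V → ℝ) (n : ℕ) (u : V) : ℝ :=
  ∑' v : chiPow G n u, ∏ j ∈ Finset.range n, lam ((par G)^[j] v) ^ 2

/-- The limit `lim_n ∑_{v ∈ chiⁿ(u)} ∏_{j < n} lam (parʲ v)²`. -/
def alpha (lam : V → ℝ) (u : V) : ℝ := limUnder atTop fun n => alphaSum G lam n u

end Shift

/-! ### Asymptotic limit and isometric asymptote of a contraction -/

section Operator

variable {H : Type*} [NormedAddCommGroup H] [InnerProductSpace ℂ H]

/-- The stable subspace: all vectors whose orbit converges to `0`. -/
def stableSubspace (T : H →L[ℂ] H) : Submodule ℂ H where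
  carrier := {h | Tendsto (fun n : ℕ => (T ^ n) h) atTop (𝓝 0)}
  zero_mem' := by
    change Tendsto (fun n : ℕ => (T ^ n) (0 : H)) atTop (𝓝 0)
    simp only [map_zero]
    exact tendsto_const_nhds
  add_mem' {a b} ha hb := by
    change Tendsto (fun n : ℕ => (T ^ n) (a + b)) atTop (𝓝 0)
    have h := Tendsto.add (f := fun n : ℕ => (T ^ n) a) (g := fun n : ℕ => (T ^ n) b) ha hb
    rw [add_zero] at h
    exact h.congr fun n => ((T ^ n).map_add a b).symm
  smul_mem' c x hx := by
    change Tendsto (fun n : ℕ => (T ^ n) (c • x)) atTop (𝓝 0)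
    have h := Tendsto.const_smul (f := fun n : ℕ => (T ^ n) x) hx c
    rw [smul_zero] at h
    exact h.congr fun n => ((T ^ n).map_smul c x).symm

/-- `T` is stable (of class `C_{0·}`). -/
def IsStable (T : H →L[ℂ] H) : Prop := stableSubspace T = ⊤

lemma antitone_orbit {T : H →L[ℂ] H} (hT : ‖T‖ ≤ 1) (h : H) :
    Antitone fun n : ℕ => ‖(T ^ n) h‖ := by
  refine antitone_nat_of_succ_le fun n => ?_
  rw [pow_succ', mul_apply_eq_comp]
  exact (T.le_of_opNorm_le hT _).trans (by rw [one_mul])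

variable [CompleteSpace H]

/-- `A` is the limit of `T*ⁿ Tⁿ` in the strong operator topology. -/
def IsAsymptoticLimit (T A : H →L[ℂ] H) : Prop :=
  ∀ h, Tendsto (fun n : ℕ => ((ContinuousLinearMap.adjoint T) ^ n) ((T ^ n) h)) atTop (𝓝 (A h))

lemma norm_pow_le_one {T : H →L[ℂ] H} (hT : ‖T‖ ≤ 1) (n : ℕ) : ‖T ^ n‖ ≤ 1 := by
  induction n with
  | zero => rw [pow_zero]; exact ContinuousLinearMap.norm_id_le
  | succ k ih =>
    rw [pow_succ]
    exact (norm_mul_le _ _).trans (mul_le_one₀ ih (norm_nonneg _) hT)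

lemma adjoint_pow' (T : H →L[ℂ] H) (n : ℕ) :
    (ContinuousLinearMap.adjoint T) ^ n = ContinuousLinearMap.adjoint (T ^ n) := by
  rw [← ContinuousLinearMap.star_eq_adjoint, ← ContinuousLinearMap.star_eq_adjoint, star_pow]

lemma inner_gram (T : H →L[ℂ] H) (n : ℕ) (x y : H) :
    inner ℂ (((ContinuousLinearMap.adjoint T) ^ n) ((T ^ n) x)) y
      = inner ℂ ((T ^ n) x) ((T ^ n) y) := by
  rw [adjoint_pow', ContinuousLinearMap.adjoint_inner_left]

lemma norm_gram_sub_sq_le {T : H →L[ℂ] H} (hT : ‖T‖ ≤ 1) (n k : ℕ) (h : H) :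
    ‖((ContinuousLinearMap.adjoint T) ^ n) ((T ^ n) h)
        - ((ContinuousLinearMap.adjoint T) ^ (n + k)) ((T ^ (n + k)) h)‖ ^ 2
      ≤ ‖(T ^ n) h‖ ^ 2 - ‖(T ^ (n + k)) h‖ ^ 2 := by
  have hTs : ‖ContinuousLinearMap.adjoint T‖ ≤ 1 := by simpa using hT
  set x := (T ^ n) h with hx
  have e1 : (T ^ (n + k)) h = (T ^ k) x := by rw [add_comm, pow_add]; rfl
  set y := ((ContinuousLinearMap.adjoint T) ^ k) ((T ^ k) x) with hy
  have e2 : ((ContinuousLinearMap.adjoint T) ^ n) x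
        - ((ContinuousLinearMap.adjoint T) ^ (n + k)) ((T ^ (n + k)) h)
      = ((ContinuousLinearMap.adjoint T) ^ n) (x - y) := by
    rw [e1, pow_add, map_sub]; rfl
  rw [e2, e1]
  have h1 : ‖((ContinuousLinearMap.adjoint T) ^ n) (x - y)‖ ≤ ‖x - y‖ := by
    simpa using (((ContinuousLinearMap.adjoint T) ^ n).le_of_opNorm_le
      (norm_pow_le_one hTs n) (x - y))
  have h2 : ‖y‖ ≤ ‖(T ^ k) x‖ := by
    simpa only [one_mul] using (((ContinuousLinearMap.adjoint T) ^ k).le_of_opNorm_le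
      (norm_pow_le_one hTs k) ((T ^ k) x))
  have h3 : RCLike.re (inner ℂ x y) = ‖(T ^ k) x‖ ^ 2 := by
    rw [inner_re_symm, hy, inner_gram, inner_self_eq_norm_sq]
  have h4 := norm_sub_sq (𝕜 := ℂ) x y
  rw [h3] at h4
  have h5 : ‖y‖ ^ 2 ≤ ‖(T ^ k) x‖ ^ 2 := by gcongr
  have h6 : ‖((ContinuousLinearMap.adjoint T) ^ n) (x - y)‖ ^ 2 ≤ ‖x - y‖ ^ 2 := by gcongr
  linarith

theorem exists_asymptoticLimit (T : H →L[ℂ] H) (hT : ‖T‖ ≤ 1) :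
    ∃ A, IsAsymptoticLimit T A := by
  have hlim : ∀ h, ∃ y, Tendsto
      (fun n : ℕ => ((ContinuousLinearMap.adjoint T) ^ n) ((T ^ n) h)) atTop (𝓝 y) := by
    intro h
    apply cauchySeq_tendsto_of_complete
    have hanti : Antitone fun n : ℕ => ‖(T ^ n) h‖ ^ 2 := fun n m hnm => by
      have := antitone_orbit hT h hnm
      simp only at this ⊢
      gcongr
    have hc : Tendsto (fun n : ℕ => ‖(T ^ n) h‖ ^ 2) atTop (𝓝 (⨅ n : ℕ, ‖(T ^ n) h‖ ^ 2)) :=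
      tendsto_atTop_ciInf hanti ⟨0, by rintro _ ⟨n, rfl⟩; positivity⟩
    have hcau := hc.cauchySeq
    rw [Metric.cauchySeq_iff'] at hcau ⊢
    intro ε hε
    obtain ⟨N, hN⟩ := hcau (ε ^ 2) (by positivity)
    refine ⟨N, fun n hn => ?_⟩
    obtain ⟨k, rfl⟩ := Nat.exists_eq_add_of_le hn
    have h1 := hN (N + k) hn
    rw [dist_comm, Real.dist_eq] at h1
    have h2 := norm_gram_sub_sq_le hT N k h
    rw [dist_comm, dist_eq_norm]
    exact lt_of_pow_lt_pow_left₀ 2 hε.le (h2.trans_lt ((le_abs_self _).trans_lt h1))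
  choose A hA using hlim
  exact ⟨continuousLinearMapOfTendsto
    (fun n : ℕ => (ContinuousLinearMap.adjoint T) ^ n * T ^ n) (tendsto_pi_nhds.2 hA), hA⟩

/-- The asymptotic limit `lim T*ⁿ Tⁿ` (in the strong operator topology) of a contraction. -/
def asymptoticLimit (T : H →L[ℂ] H) (hT : ‖T‖ ≤ 1) : H →L[ℂ] H :=
  (exists_asymptoticLimit T hT).choose

lemma asymptoticLimit_spec (T : H →L[ℂ] H) (hT : ‖T‖ ≤ 1) :
    IsAsymptoticLimit T (asymptoticLimit T hT) := (exists_asymptoticLimit T hT).choose_spec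

lemma tendsto_norm_sq_orbit (T : H →L[ℂ] H) (hT : ‖T‖ ≤ 1) (h : H) :
    Tendsto (fun n : ℕ => (((‖(T ^ n) h‖ ^ 2 : ℝ)) : ℂ)) atTop
      (𝓝 (inner ℂ (asymptoticLimit T hT h) h)) := by
  refine ((asymptoticLimit_spec T hT h).inner tendsto_const_nhds).congr fun n => ?_
  rw [inner_gram, inner_self_eq_norm_sq_to_K]
  norm_cast

lemma tendsto_norm_sq_orbit_re (T : H →L[ℂ] H) (hT : ‖T‖ ≤ 1) (h : H) :
    Tendsto (fun n : ℕ => ‖(T ^ n) h‖ ^ 2) atTop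
      (𝓝 (inner ℂ (asymptoticLimit T hT h) h).re) :=
  (Complex.continuous_re.tendsto _).comp (tendsto_norm_sq_orbit T hT h)

lemma asymptoticLimit_nonneg (T : H →L[ℂ] H) (hT : ‖T‖ ≤ 1) : 0 ≤ asymptoticLimit T hT := by
  rw [ContinuousLinearMap.nonneg_iff_isPositive, ContinuousLinearMap.isPositive_iff_complex]
  intro x
  have h1 := tendsto_norm_sq_orbit_re T hT x
  have h2 := (Complex.continuous_ofReal.tendsto _).comp h1
  exact ⟨tendsto_nhds_unique h2 (tendsto_norm_sq_orbit T hT x),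
    ge_of_tendsto' h1 fun n => by positivity⟩

lemma sqrt_selfAdjoint (A : H →L[ℂ] H) (x y : H) :
    inner ℂ (CFC.sqrt A x) y = inner ℂ x (CFC.sqrt A y) := by
  have h := (ContinuousLinearMap.nonneg_iff_isPositive _).1 (CFC.sqrt_nonneg A)
  exact h.inner_left_eq_inner_right x y

lemma tendsto_sqrt (T : H →L[ℂ] H) (hT : ‖T‖ ≤ 1) (h : H) :
    Tendsto (fun n : ℕ => ‖(T ^ n) h‖ ^ 2) atTop
      (𝓝 (‖CFC.sqrt (asymptoticLimit T hT) h‖ ^ 2)) := by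
  convert tendsto_norm_sq_orbit_re T hT h using 2
  set B := CFC.sqrt (asymptoticLimit T hT) with hB
  have h1 : asymptoticLimit T hT h = B (B h) := by
    have := CFC.sqrt_mul_sqrt_self (asymptoticLimit T hT) (asymptoticLimit_nonneg T hT)
    conv_lhs => rw [← this]
    rfl
  rw [h1, hB, sqrt_selfAdjoint]
  exact (inner_self_eq_norm_sq (𝕜 := ℂ) _).symm

lemma mem_stableSubspace_iff (T : H →L[ℂ] H) (hT : ‖T‖ ≤ 1) (h : H) :
    h ∈ stableSubspace T ↔ CFC.sqrt (asymptoticLimit T hT) h = 0 := by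
  have key : h ∈ stableSubspace T ↔ Tendsto (fun n : ℕ => ‖(T ^ n) h‖ ^ 2) atTop (𝓝 0) := by
    change Tendsto (fun n : ℕ => (T ^ n) h) atTop (𝓝 0) ↔ _
    rw [tendsto_zero_iff_norm_tendsto_zero]
    constructor
    · intro h1
      simpa only [ne_eq, OfNat.ofNat_ne_zero, not_false_eq_true, zero_pow] using h1.pow 2
    · intro h1
      have h2 := h1.sqrt
      simpa only [Real.sqrt_zero, Real.sqrt_sq (norm_nonneg _)] using h2
  rw [key]
  constructor
  · intro h1
    have := tendsto_nhds_unique h1 (tendsto_sqrt T hT h)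
    simpa using this.symm
  · intro h1
    have := tendsto_sqrt T hT h
    rw [h1] at this
    simpa only [norm_zero, ne_eq, OfNat.ofNat_ne_zero, not_false_eq_true, zero_pow] using this

/-- The intertwining map `X h = A^{1/2} h` with values in the orthocomplement of the stable
subspace, where `A` is the asymptotic limit of the contraction `T`. -/
def asymptoteMap (T : H →L[ℂ] H) (hT : ‖T‖ ≤ 1) : H →L[ℂ] (stableSubspace T)ᗮ :=
  (CFC.sqrt (asymptoticLimit T hT)).codRestrict _ fun h => by
    rw [Submodule.mem_orthogonal]
    intro u hu
    rw [← sqrt_selfAdjoint, (mem_stableSubspace_iff T hT u).1 hu, inner_zero_left]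

lemma asymptoteMap_norm_comp (T : H →L[ℂ] H) (hT : ‖T‖ ≤ 1) (h : H) :
    ‖asymptoteMap T hT (T h)‖ = ‖asymptoteMap T hT h‖ := by
  have h1 := tendsto_sqrt T hT (T h)
  have h2 := (tendsto_add_atTop_iff_nat 1).2 (tendsto_sqrt T hT h)
  have h3 := tendsto_nhds_unique (h1.congr fun n => by rw [pow_succ]; rfl) h2
  exact (sq_eq_sq₀ (norm_nonneg _) (norm_nonneg _)).1 h3

lemma asymptoteMap_denseRange (T : H →L[ℂ] H) (hT : ‖T‖ ≤ 1) :
    DenseRange (asymptoteMap T hT) := by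
  have h1 : (LinearMap.range (asymptoteMap T hT).toLinearMap)ᗮ = ⊥ := by
    rw [Submodule.eq_bot_iff]
    intro x hx
    rw [Submodule.mem_orthogonal] at hx
    have h2 : CFC.sqrt (asymptoticLimit T hT) (x : H) = 0 := by
      have h3 := hx (asymptoteMap T hT (CFC.sqrt (asymptoticLimit T hT) (x : H))) ⟨_, rfl⟩
      rw [Submodule.coe_inner] at h3
      change inner ℂ (CFC.sqrt (asymptoticLimit T hT)
        (CFC.sqrt (asymptoticLimit T hT) (x : H))) (x : H) = 0 at h3
      rw [sqrt_selfAdjoint] at h3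
      exact inner_self_eq_zero.1 h3
    have h4 := (mem_stableSubspace_iff T hT _).2 h2
    have h5 := (Submodule.mem_orthogonal _ _).1 x.2 _ h4
    exact Subtype.ext (inner_self_eq_zero.1 h5)
  have h6 := (Submodule.topologicalClosure_eq_top_iff
    (K := LinearMap.range (asymptoteMap T hT).toLinearMap)).2 h1
  exact Submodule.dense_iff_topologicalClosure_eq_top.2 h6

/-- There is a unique isometry `U` with `X T = U X`. -/
theorem existsUnique_isometricAsymptote (T : H →L[ℂ] H) (hT : ‖T‖ ≤ 1) :
    ∃! U : (stableSubspace T)ᗮ →ₗᵢ[ℂ] (stableSubspace T)ᗮ,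
      ∀ h, asymptoteMap T hT (T h) = U (asymptoteMap T hT h) := by
  set X := asymptoteMap T hT with hX
  have hd : DenseRange X.toLinearMap := asymptoteMap_denseRange T hT
  have hn : ∃ C : ℝ, ∀ x, ‖(X.toLinearMap ∘ₗ T.toLinearMap) x‖ ≤ C * ‖X.toLinearMap x‖ :=
    ⟨1, fun x => by rw [one_mul]; exact (asymptoteMap_norm_comp T hT x).le⟩
  set U₀ := (X.toLinearMap ∘ₗ T.toLinearMap).extendOfNorm X.toLinearMap with hU₀
  have hU : ∀ h, U₀ (X h) = X (T h) := fun h => LinearMap.extendOfNorm_eq hd hn h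
  refine ⟨⟨U₀.toLinearMap, fun y => ?_⟩, fun h => (hU h).symm, fun W hW => ?_⟩
  · refine hd.induction_on (p := fun y => ‖U₀ y‖ = ‖y‖) y
      (isClosed_eq (by fun_prop) (by fun_prop)) fun h => ?_
    exact (congrArg norm (hU h)).trans (asymptoteMap_norm_comp T hT h)
  · ext1 y
    refine hd.induction_on (p := fun y => W y = U₀ y) y
      (isClosed_eq W.continuous U₀.continuous) fun h => ?_
    exact (hW h).symm.trans (hU h).symm

/-- The isometric asymptote of a contraction `T`: the unique isometry `U` on the orthocomplement
of the stable subspace (the closure of the range of `A`) with `X T = U X`. -/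
def isometricAsymptote (T : H →L[ℂ] H) (hT : ‖T‖ ≤ 1) :
    (stableSubspace T)ᗮ →ₗᵢ[ℂ] (stableSubspace T)ᗮ :=
  (existsUnique_isometricAsymptote T hT).choose

lemma isometricAsymptote_spec (T : H →L[ℂ] H) (hT : ‖T‖ ≤ 1) (h : H) :
    asymptoteMap T hT (T h) = isometricAsymptote T hT (asymptoteMap T hT h) :=
  (existsUnique_isometricAsymptote T hT).choose_spec.1 h

/-- A completely non-unitary operator: the only reducing (closed, invariant under `T` and `T*`)
subspace on which `T` acts as a unitary operator is `{0}`. -/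
def IsCNU (T : H →L[ℂ] H) : Prop :=
  ∀ M : Submodule ℂ H, IsClosed (M : Set H) → (∀ x ∈ M, T x ∈ M) →
    (∀ x ∈ M, ContinuousLinearMap.adjoint T x ∈ M) →
    (∀ x ∈ M, ‖T x‖ = ‖x‖) → (∀ y ∈ M, ∃ x ∈ M, T x = y) → M = ⊥

end Operator

/-! ### Unitary equivalence, direct sums and the simple shifts -/

/-- Unitary equivalence of operators. -/
def UnitarilyEquivalent {H K : Type*} [NormedAddCommGroup H] [InnerProductSpace ℂ H]
    [NormedAddCommGroup K] [InnerProductSpace ℂ K] (T : H →L[ℂ] H) (T' : K →L[ℂ] K) : Prop :=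
  ∃ W : H ≃ₗᵢ[ℂ] K, ∀ x, W (T x) = T' (W x)

/-- The simple bilateral shift `e n ↦ e (n + 1)` on the square summable functions on `ℤ`. -/
def bilateralShift : Ell2 ℤ →ₗᵢ[ℂ] Ell2 ℤ := ell2Map (fun n : ℤ => n + 1) (add_left_injective 1)

/-- The simple unilateral shift `e k ↦ e (k + 1)` on the square summable functions on `ℕ`. -/
def unilateralShift : Ell2 ℕ →ₗᵢ[ℂ] Ell2 ℕ := ell2Map (fun n : ℕ => n + 1) (add_left_injective 1)

/-- An index set with `n` elements (countably infinite if `n = ∞`). -/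
abbrev IndexSet (n : ℕ∞) : Type := {i : ℕ // (i : ℕ∞) < n}

/-- The Hilbert space direct sum of `n` copies of the square summable functions on `ℕ`. -/
abbrev Ell2Copies (n : ℕ∞) : Type := lp (fun _ : IndexSet n => Ell2 ℕ) 2

/-- The unilateral shift of multiplicity `n`: the orthogonal sum of `n` copies of the simple
unilateral shift (countably infinitely many if `n = ∞`). -/
def unilateralShiftMult (n : ℕ∞) : Ell2Copies n →L[ℂ] Ell2Copies n :=
  lp.mapCLM 2 (fun _ : IndexSet n => unilateralShift.toContinuousLinearMap) zero_le_one
    (fun _ => LinearIsometry.norm_toContinuousLinearMap_le _)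

/-- The orthogonal sum of two operators on the Hilbert space direct sum. -/
def orthSum {H K : Type*} [NormedAddCommGroup H] [InnerProductSpace ℂ H]
    [NormedAddCommGroup K] [InnerProductSpace ℂ K] (T : H →L[ℂ] H) (T' : K →L[ℂ] K) :
    WithLp 2 (H × K) →L[ℂ] WithLp 2 (H × K) :=
  (WithLp.prodContinuousLinearEquiv 2 ℂ H K).symm.toContinuousLinearMap ∘L
    (T.prodMap T') ∘L (WithLp.prodContinuousLinearEquiv 2 ℂ H K).toContinuousLinearMap

/-! ### The subtree carrying the orthocomplement of the stable subspace -/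

section Subtree

variable {V : Type*} (G : Digraph V) (lam : V → ℝ) (h : BoundedWeights G lam)

/-- The set `V'` of vertices whose basis vectors lie in the orthocomplement of the stable
subspace of the weighted shift. -/
def coreSet : Set V := {v | basisVec v ∈ (stableSubspace (weightedShift G lam h))ᗮ}

/-- The weights `lam v * √(alpha v) / √(alpha (par v))` on `V'`. -/
def coreWeight (v : coreSet G lam h) : ℝ :=
  lam v * √(alpha G lam v) / √(alpha G lam (par G v))

/-- The subgraph `T'` on `V'`. -/
def coreTree : Digraph (coreSet G lam h) := inducedGraph G (coreSet G lam h)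

end Subtree

end TreeShift

end

open TreeShift

/-! For distinct `u` the vectors `S^n e_u` live on disjoint generations, so each `S*^n S^n` is
diagonal in the standard basis. Hence `A` and `A^{1/2}` are diagonal too, with entries `alpha u` and
`√(alpha u)` (`asymptoticLimit_basisVec`, `asymptoteMap_coord`), and the stable vectors are those
vanishing on `V' = {alpha > 0}`. Parseval applied to `‖A^{1/2} S e_u‖ = ‖A^{1/2} e_u‖` gives the
recursion `alpha u = ∑ lam v ^ 2 * alpha v` over the children (`hasSum_alpha`). From it follow that
`V'` is closed under parents, that it has no leaves, and that the squares of the weights `β` sum to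
one over the children of each vertex. Conjugation by the diagonal operator `A^{1/2}` turns the
weights `lam` into `β` (`isometricAsymptote_coreEquiv`).

What remains is the Wold decomposition of an isometric weighted shift on a leafless tree. Its range
consists of the square summable functions that are proportional to the weights on every set of
siblings and vanish at the root. The orthocomplement of the range therefore has one dimension for
each child but one of every vertex, and one more for a root (`exists_wandering_family`,
`card_not_isFirstChild`). This gives the multiplicity of `S^+`.

The unitary part is the intersection of the ranges of all powers. A vector there satisfies `f v = (∏
β) * g (par^n v)` for every `n`, so a root forces `f = 0`. Without a root, `f` is on each level a
multiple of the square root of the infinite path product. These products vanish everywhere or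
nowhere; in the second case each level carries exactly one line, which the shift moves to the next
level, so the unitary part is a single bilateral shift (`exists_bilateral_sequence`). -/

namespace TreeShift

/-! ### Ancestors, levels and countability in a directed tree. -/

section Tree

variable {V : Type*} {G : Digraph V}

lemma par_eq_self_of_isRoot {v : V} (h : IsRoot G v) : par G v = v := by
  rw [par, dif_neg]
  rintro ⟨u, hu⟩
  exact h u hu

lemma not_isRoot_iff {v : V} : ¬ IsRoot G v ↔ ∃ u, G.Adj u v := by
  simp [IsRoot]

lemma adj_par_of_not_isRoot {v : V} (h : ¬ IsRoot G v) : G.Adj (par G v) v :=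
  adj_par G (not_isRoot_iff.1 h)

lemma iterate_par_of_isRoot {v : V} (h : IsRoot G v) (n : ℕ) : (par G)^[n] v = v :=
  Function.iterate_fixed (par_eq_self_of_isRoot h) n

lemma transGen_iterate_par (hr : ¬ HasRoot G) (n : ℕ) (v : V) :
    Relation.TransGen G.Adj ((par G)^[n + 1] v) v := by
  induction n with
  | zero => exact .single (adj_par_of_not_isRoot fun h => hr ⟨_, h⟩)
  | succ n ih =>
    rw [Function.iterate_succ_apply']
    exact .head (adj_par_of_not_isRoot fun h => hr ⟨_, h⟩) ih

lemma mem_gen_self (u : V) : u ∈ gen G u := ⟨0, u, by simp [chiPow], by simp [chiPow]⟩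

namespace IsDirectedTree

variable (hG : IsDirectedTree G)
include hG

lemma par_eq {u v : V} (h : G.Adj u v) : par G v = u := TreeShift.par_eq hG.parent_unique h

/-- An edge changes one of the two exponents by at most one, so a common ancestor survives along any
undirected path. As `par` fixes the root, the iterates never become undefined. -/
lemma exists_iterate_par_eq (u v : V) : ∃ m n : ℕ, (par G)^[m] u = (par G)^[n] v := by
  induction hG.connected u v with
  | refl => exact ⟨0, 0, rfl⟩
  | @tail b c _ h ih =>
    obtain ⟨m, n, h1⟩ := ih
    rcases h with h | h
    · refine ⟨m, n + 1, ?_⟩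
      rw [h1, Function.iterate_succ_apply, hG.par_eq h]
    · cases n with
      | zero =>
        refine ⟨m + 1, 0, ?_⟩
        rw [Function.iterate_succ_apply', h1]
        exact hG.par_eq h
      | succ n =>
        refine ⟨m, n, ?_⟩
        rw [h1, Function.iterate_succ_apply, hG.par_eq h]

lemma isRoot_unique {r r' : V} (h : IsRoot G r) (h' : IsRoot G r') : r = r' := by
  obtain ⟨m, n, h1⟩ := hG.exists_iterate_par_eq r r'
  rwa [iterate_par_of_isRoot h, iterate_par_of_isRoot h'] at h1

/-- A property that passes between a vertex and its parent holds everywhere if it holds once. -/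
lemma forall_of_iff_par {p : V → Prop} (h : ∀ v, p v ↔ p (par G v)) {u : V} (hu : p u) (v : V) :
    p v := by
  have h' : ∀ (n : ℕ) v, p v ↔ p ((par G)^[n] v) := by
    intro n
    induction n with
    | zero => intro v; rfl
    | succ n ih => intro v; rw [Function.iterate_succ_apply, ← ih, ← h]
  obtain ⟨m, n, h1⟩ := hG.exists_iterate_par_eq u v
  rw [h' n v, ← h1, ← h' m u]
  exact hu

lemma countable (hchi : ∀ u, (chi G u).Countable) : Countable V := by
  rcases isEmpty_or_nonempty V with hV | ⟨⟨o⟩⟩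
  · infer_instance
  have hdesc : ∀ (n : ℕ) u, {v | (par G)^[n] v = u}.Countable := by
    intro n
    induction n with
    | zero => intro u; simp
    | succ n ih =>
      intro u
      -- The vertex `u` itself is inserted because a root is its own `par`, without being its own
      -- child.
      have : {v | (par G)^[n + 1] v = u} ⊆ ⋃ w ∈ insert u (chi G u), {v | (par G)^[n] v = w} := by
        intro v hv
        simp only [Set.mem_iUnion, Set.mem_ofPred_eq, exists_prop]
        refine ⟨_, ?_, rfl⟩
        rw [Set.mem_ofPred_eq, Function.iterate_succ_apply'] at hv
        by_cases hr : IsRoot G ((par G)^[n] v)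
        · left
          rw [← hv, par_eq_self_of_isRoot hr]
        · right
          rw [← hv]
          exact adj_par_of_not_isRoot hr
      exact (((hchi u).insert u).biUnion fun w _ => ih w).mono this
  rw [← Set.countable_univ_iff]
  refine (Set.countable_iUnion fun m : ℕ => Set.countable_iUnion fun n : ℕ =>
    hdesc n ((par G)^[m] o)).mono fun v _ => ?_
  obtain ⟨m, n, h⟩ := hG.exists_iterate_par_eq o v
  simp only [Set.mem_iUnion]
  exact ⟨m, n, h.symm⟩

lemma iterate_par_injective (hr : ¬ HasRoot G) (v : V) :
    Function.Injective fun n : ℕ => (par G)^[n] v := by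
  have key : ∀ a k : ℕ, (par G)^[a] v ≠ (par G)^[a + (k + 1)] v := by
    intro a k h
    rw [add_comm, Function.iterate_add_apply] at h
    have := transGen_iterate_par hr k ((par G)^[a] v)
    rw [← h] at this
    exact hG.acyclic _ this
  intro a b h
  rcases lt_trichotomy a b with hab | hab | hab
  · obtain ⟨k, rfl⟩ := Nat.exists_eq_add_of_lt hab
    exact absurd h (key a k)
  · exact hab
  · obtain ⟨k, rfl⟩ := Nat.exists_eq_add_of_lt hab
    exact absurd h.symm (key b k)

/-- In a rootless tree there is a level function, which increases by one along edges. -/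
lemma exists_height (hr : ¬ HasRoot G) :
    ∃ ht : V → ℤ, (∀ v, ht v = ht (par G v) + 1) ∧
      ∀ v w, ht v = ht w → ∃ n : ℕ, (par G)^[n] v = (par G)^[n] w := by
  rcases isEmpty_or_nonempty V with hV | ⟨⟨o⟩⟩
  · exact ⟨fun _ => 0, fun v => (hV.false v).elim, fun v => (hV.false v).elim⟩
  choose m n hmn using fun v => hG.exists_iterate_par_eq v o
  -- The difference of the two exponents does not depend on the chosen common ancestor, because the
  -- ancestors of `o` are pairwise distinct. It serves as the level of `v` relative to `o`.
  have key : ∀ v (a b : ℕ), (par G)^[a] v = (par G)^[b] o → (m v : ℤ) - n v = a - b := by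
    intro v a b h
    have h1 : (par G)^[a + n v] o = (par G)^[m v + b] o := by
      rw [Function.iterate_add_apply, ← hmn, ← Function.iterate_add_apply, add_comm,
        Function.iterate_add_apply, h, ← Function.iterate_add_apply]
    have h2 := hG.iterate_par_injective hr o h1
    omega
  refine ⟨fun v => (m v : ℤ) - n v, fun v => ?_, fun v w h => ?_⟩
  · change (m v : ℤ) - n v = m (par G v) - n (par G v) + 1
    rw [key v (m (par G v) + 1) (n (par G v)) (by rw [Function.iterate_succ_apply, hmn])]
    push_cast
    ring
  · have h' : m v + n w = m w + n v := by
      simp only at h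
      omega
    refine ⟨m v + n w, ?_⟩
    calc (par G)^[m v + n w] v = (par G)^[n w + n v] o := by
          rw [add_comm, Function.iterate_add_apply, hmn, ← Function.iterate_add_apply]
      _ = (par G)^[n v + m w] w := by
          rw [Function.iterate_add_apply _ (n v), hmn, ← Function.iterate_add_apply, add_comm]
      _ = (par G)^[m v + n w] w := by rw [h', add_comm]

lemma mem_chiPow {n : ℕ} {u v : V} :
    v ∈ chiPow G n u ↔ (par G)^[n] v = u ∧ ∀ j < n, ¬ IsRoot G ((par G)^[j] v) := by
  induction n generalizing v with
  | zero => simp [chiPow]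
  | succ n ih =>
    have h : v ∈ chiPow G (n + 1) u ↔ ∃ w ∈ chiPow G n u, G.Adj w v := by
      rw [chiPow, Function.iterate_succ_apply']
      change v ∈ ⋃ w ∈ chiPow G n u, chi G w ↔ _
      simp only [Set.mem_iUnion, exists_prop]
      rfl
    rw [h]
    constructor
    · rintro ⟨w, hw, hwv⟩
      obtain rfl := hG.par_eq hwv
      obtain ⟨h1, h2⟩ := ih.1 hw
      refine ⟨h1, fun j hj => ?_⟩
      cases j with
      | zero => exact not_isRoot_iff.2 ⟨_, hwv⟩
      | succ j => exact h2 j (by omega)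
    · rintro ⟨h1, h2⟩
      refine ⟨par G v, ih.2 ⟨h1, fun j hj => h2 (j + 1) (by omega)⟩, ?_⟩
      exact adj_par_of_not_isRoot (h2 0 (by omega))

/-- A nonempty set of vertices that is closed under parents carries a directed tree. -/
lemma inducedGraph {W : Set V} (hW : ∀ v ∈ W, par G v ∈ W) :
    IsDirectedTree (inducedGraph G W) where
  connected := by
    have key : ∀ (n : ℕ) (v w : W), (w : V) = (par G)^[n] v → Relation.ReflTransGen
        (fun a b => (TreeShift.inducedGraph G W).Adj a b ∨
          (TreeShift.inducedGraph G W).Adj b a) v w := by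
      intro n
      induction n with
      | zero => intro v w h; rw [Subtype.ext h]
      | succ n ih =>
        intro v w h
        by_cases hr : IsRoot G v.1
        · refine ih v w (h.trans ?_)
          rw [iterate_par_of_isRoot hr, iterate_par_of_isRoot hr]
        · refine .head (b := ⟨par G v, hW _ v.2⟩) (Or.inr ?_) (ih ⟨par G v, hW _ v.2⟩ w h)
          exact adj_par_of_not_isRoot (v := v.1) hr
    intro u v
    obtain ⟨m, n, h⟩ := hG.exists_iterate_par_eq u.1 v.1
    have hmem : ∀ k : ℕ, (par G)^[k] u.1 ∈ W := by
      intro k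
      induction k with
      | zero => exact u.2
      | succ k ih => rw [Function.iterate_succ_apply']; exact hW _ ih
    have : Std.Symm (fun a b => (TreeShift.inducedGraph G W).Adj a b ∨
      (TreeShift.inducedGraph G W).Adj b a) := ⟨fun a b hab => hab.symm⟩
    exact (key m u ⟨_, hmem m⟩ rfl).trans (Relation.ReflTransGen.stdSymm.symm _ _
      (key n v ⟨_, hmem m⟩ h))
  parent_unique u u' v h h' := Subtype.ext (hG.parent_unique _ _ _ h h')
  acyclic v h := hG.acyclic v.1 (h.lift Subtype.val fun a b hab => hab)

end IsDirectedTree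

end Tree

/-! ### Coordinates of the shift and of its powers. -/

section EffectiveWeight

variable {V : Type*} (G : Digraph V)

open Classical in
/-- The weights, with the irrelevant value at a root replaced by `0`. -/
noncomputable def effWeight (lam : V → ℝ) (v : V) : ℝ := if IsRoot G v then 0 else lam v

variable {G}

/-- A zero weight at the root absorbs the case distinction in `shiftFun`, so that powers are given
by plain products along the path of ancestors. -/
lemma weightedShift_coord {lam : V → ℝ} (h : BoundedWeights G lam) (f : Ell2 V) (v : V) :
    weightedShift G lam h f v = (effWeight G lam v : ℂ) * f (par G v) := by
  rw [weightedShift_apply, shiftFun, effWeight]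
  by_cases hv : IsRoot G v
  · rw [if_neg (by rwa [← not_isRoot_iff, not_not]), if_pos hv]
    simp
  · rw [if_pos (not_isRoot_iff.1 hv), if_neg hv]

lemma weightedShift_pow_coord {lam : V → ℝ} (h : BoundedWeights G lam) (n : ℕ) (f : Ell2 V)
    (v : V) : (weightedShift G lam h ^ n) f v =
      ((∏ j ∈ Finset.range n, effWeight G lam ((par G)^[j] v) : ℝ) : ℂ) * f ((par G)^[n] v) := by
  induction n generalizing v with
  | zero => simp
  | succ n ih =>
    rw [pow_succ']
    change weightedShift G lam h ((weightedShift G lam h ^ n) f) v = _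
    rw [weightedShift_coord, ih, Finset.prod_range_succ']
    simp only [Function.iterate_succ_apply, Function.iterate_zero, id]
    push_cast
    ring

open Classical in
lemma basisVec_apply {ι : Type*} (i j : ι) : (basisVec i : Ell2 ι) j = if j = i then 1 else 0 := by
  rw [basisVec, lp.single_apply, Pi.single_apply]

lemma inner_basisVec_left {ι : Type*} (i : ι) (f : Ell2 ι) : inner ℂ (basisVec i) f = f i := by
  classical
  have := lp.inner_single_left (𝕜 := ℂ) i (1 : ℂ) f
  rw [basisVec]
  convert this using 1
  simp

lemma norm_basisVec {ι : Type*} (i : ι) : ‖(basisVec i : Ell2 ι)‖ = 1 := by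
  classical
  rw [basisVec, lp.norm_single (by norm_num)]
  simp

lemma hasSum_norm_sq {ι : Type*} (f : Ell2 ι) : HasSum (fun i => ‖f i‖ ^ 2) (‖f‖ ^ 2) := by
  have := lp.hasSum_norm (p := 2) (by norm_num) f
  simpa using this

lemma norm_coord_le {ι : Type*} (f : Ell2 ι) (i : ι) : ‖f i‖ ≤ ‖f‖ :=
  lp.norm_apply_le_norm (by norm_num) f i

lemma mem_ell2Sub {ι : Type*} {W : Set ι} {f : Ell2 ι} :
    f ∈ ell2Sub W ↔ ∀ i, i ∉ W → f i = 0 := by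
  constructor
  · intro hf i hi
    have hle : ell2Sub W ≤ (Submodule.span ℂ {basisVec i})ᗮ := by
      refine Submodule.topologicalClosure_minimal _ ?_ (Submodule.isClosed_orthogonal _)
      rw [Submodule.span_le]
      rintro _ ⟨j, hj, rfl⟩
      rw [SetLike.mem_coe, Submodule.mem_orthogonal_singleton_iff_inner_right,
        inner_basisVec_left, basisVec_apply, if_neg]
      rintro rfl
      exact hi hj
    rw [← inner_basisVec_left]
    exact Submodule.mem_orthogonal_singleton_iff_inner_right.1 (hle hf)
  · intro hf
    classical
    have h1 := lp.hasSum_single (E := fun _ : ι => ℂ) (p := 2) (by norm_num) f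
    refine (Submodule.isClosed_topologicalClosure _).mem_of_tendsto h1
      (Eventually.of_forall fun s => ?_)
    refine Submodule.sum_mem _ fun i _ => ?_
    by_cases hi : i ∈ W
    · have : lp.single (E := fun _ : ι => ℂ) 2 i (f i) = f i • basisVec i := by
        ext j
        rw [lp.coeFn_smul, Pi.smul_apply, basisVec_apply, lp.single_apply, Pi.single_apply]
        split_ifs with h <;> simp
      rw [this]
      exact Submodule.smul_mem _ _ (Submodule.le_topologicalClosure _
        (Submodule.subset_span ⟨i, hi, rfl⟩))
    · rw [hf i hi]
      have : lp.single (E := fun _ : ι => ℂ) 2 i 0 = 0 := by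
        ext j
        rw [lp.single_apply, Pi.single_zero]
        rfl
      rw [this]
      exact Submodule.zero_mem _

end EffectiveWeight

/-! ### The square root of a positive operator on eigenvectors. -/

section Sqrt

variable {H : Type*} [NormedAddCommGroup H] [InnerProductSpace ℂ H] [CompleteSpace H]

/-- With `R = A^{1/2}` and `y = R e - √a e` one has `(R + √a) y = A e - a e = 0`. So `R y = -√a y`,
which positivity of `R` excludes for `a > 0` unless `y = 0`. For `a = 0`, `y = R e` and `‖y‖ ^ 2 =
⟪e, R y⟫ = 0`. -/
lemma sqrt_apply_of_eigenvector {A : H →L[ℂ] H} (hA : 0 ≤ A) {a : ℝ} (ha : 0 ≤ a) {e : H}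
    (he : A e = (a : ℂ) • e) : CFC.sqrt A e = ((√a : ℝ) : ℂ) • e := by
  set R := CFC.sqrt A with hR
  have hRR : ∀ x, R (R x) = A x := fun x => by
    have := CFC.sqrt_mul_sqrt_self A hA
    conv_rhs => rw [← this]
    rfl
  set y := R e - ((√a : ℝ) : ℂ) • e with hy
  have hsa : ((√a : ℝ) : ℂ) * ((√a : ℝ) : ℂ) = a := by
    rw [← Complex.ofReal_mul, Real.mul_self_sqrt ha]
  have hRy : R y = -((√a : ℝ) : ℂ) • y := by
    rw [hy, map_sub, hRR, he, map_smul, smul_sub, smul_smul, neg_mul, hsa]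
    module
  have hpos : 0 ≤ (inner ℂ (R y) y).re :=
    ((ContinuousLinearMap.nonneg_iff_isPositive _).1 (CFC.sqrt_nonneg A)).re_inner_nonneg_left y
  have h1 : (inner ℂ (R y) y).re = -(√a * ‖y‖ ^ 2) := by
    rw [hRy, inner_smul_left, inner_self_eq_norm_sq_to_K]
    simp [← Complex.ofReal_pow]
  have hy0 : y = 0 := by
    rcases (Real.sqrt_nonneg a).eq_or_lt with h0 | h0
    · have h2 : y = R e := by rw [hy, ← h0]; simp
      have h3 : R y = 0 := by rw [hRy, ← h0]; simp
      have h4 : inner ℂ y y = 0 := by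
        nth_rewrite 1 [h2]
        rw [hR, sqrt_selfAdjoint, ← hR, h3, inner_zero_right]
      exact inner_self_eq_zero.1 h4
    · have h2 : ‖y‖ ^ 2 ≤ 0 := by
        by_contra! h
        have := mul_pos h0 h
        linarith
      exact norm_eq_zero.1 (pow_eq_zero_iff two_ne_zero |>.1 (le_antisymm h2 (by positivity)))
  exact sub_eq_zero.1 hy0

lemma asymptoteMap_of_eigenvector {T : H →L[ℂ] H} (hT : ‖T‖ ≤ 1) {a : ℝ} (ha : 0 ≤ a) {e : H}
    (he : asymptoticLimit T hT e = (a : ℂ) • e) :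
    (asymptoteMap T hT e : H) = ((√a : ℝ) : ℂ) • e :=
  sqrt_apply_of_eigenvector (asymptoticLimit_nonneg T hT) ha he

lemma asymptoteMap_selfAdjoint {T : H →L[ℂ] H} (hT : ‖T‖ ≤ 1) (x y : H) :
    inner ℂ (asymptoteMap T hT x : H) y = inner ℂ x (asymptoteMap T hT y : H) :=
  sqrt_selfAdjoint _ _ _

lemma mem_stableSubspace_iff_asymptoteMap {T : H →L[ℂ] H} (hT : ‖T‖ ≤ 1) (x : H) :
    x ∈ stableSubspace T ↔ (asymptoteMap T hT x : H) = 0 :=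
  mem_stableSubspace_iff T hT x

end Sqrt

/-! ### The diagonal asymptotic limit, the subtree on `V'` and the weights `β`. -/

section Core

variable {V : Type*} {G : Digraph V} {lam : V → ℝ} {hb : BoundedWeights G lam}

lemma effWeight_of_not_isRoot {v : V} (h : ¬ IsRoot G v) : effWeight G lam v = lam v := if_neg h

lemma effWeight_of_isRoot {v : V} (h : IsRoot G v) : effWeight G lam v = 0 := if_pos h

section
variable (hG : IsDirectedTree G)
include hG

lemma weightedShift_pow_basisVec (n : ℕ) {u v : V} (h : v ∈ chiPow G n u) :
    (weightedShift G lam hb ^ n) (basisVec u) v =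
      ((∏ j ∈ Finset.range n, lam ((par G)^[j] v) : ℝ) : ℂ) := by
  obtain ⟨h1, h2⟩ := hG.mem_chiPow.1 h
  rw [weightedShift_pow_coord, basisVec_apply, if_pos h1, mul_one]
  congr 1
  exact Finset.prod_congr rfl fun j hj => effWeight_of_not_isRoot (h2 j (Finset.mem_range.1 hj))

lemma weightedShift_pow_basisVec_of_notMem (n : ℕ) {u v : V} (h : v ∉ chiPow G n u) :
    (weightedShift G lam hb ^ n) (basisVec u) v = 0 := by
  rw [weightedShift_pow_coord, basisVec_apply]
  split_ifs with h1
  · rw [hG.mem_chiPow, not_and] at h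
    have h2 := h h1
    push Not at h2
    obtain ⟨j, hj, hr⟩ := h2
    rw [Finset.prod_eq_zero (f := fun j => effWeight G lam ((par G)^[j] v))
      (Finset.mem_range.2 hj) (effWeight_of_isRoot hr)]
    simp
  · simp

lemma hasSum_alphaSum (n : ℕ) (u : V) :
    HasSum (fun v : chiPow G n u => ∏ j ∈ Finset.range n, lam ((par G)^[j] v) ^ 2)
      (‖(weightedShift G lam hb ^ n) (basisVec u)‖ ^ 2) := by
  have h1 := hasSum_norm_sq ((weightedShift G lam hb ^ n) (basisVec u))
  rw [← hasSum_subtype_iff_of_support_subset (s := chiPow G n u)] at h1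
  · convert h1 using 1
    funext v
    rw [Function.comp_apply, weightedShift_pow_basisVec hG n v.2, Complex.norm_real,
      Real.norm_eq_abs, sq_abs, Finset.prod_pow]
  · intro v hv
    by_contra hv'
    apply hv
    simp only
    rw [weightedShift_pow_basisVec_of_notMem hG n hv', norm_zero, zero_pow two_ne_zero]

lemma alphaSum_eq (hb : BoundedWeights G lam) (n : ℕ) (u : V) :
    alphaSum G lam n u = ‖(weightedShift G lam hb ^ n) (basisVec u)‖ ^ 2 :=
  (hasSum_alphaSum hG n u).tsum_eq

/-- The `n`-th generations of two different vertices are disjoint, since a vertex determines its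
`n`-th ancestor. This is what makes `S*^n S^n` diagonal. -/
lemma inner_pow_basisVec_of_ne (n : ℕ) {u w : V} (h : u ≠ w) :
    inner ℂ ((weightedShift G lam hb ^ n) (basisVec u))
      ((weightedShift G lam hb ^ n) (basisVec w)) = 0 := by
  have h1 := lp.hasSum_inner (𝕜 := ℂ) ((weightedShift G lam hb ^ n) (basisVec u))
    ((weightedShift G lam hb ^ n) (basisVec w))
  refine h1.unique ?_
  convert hasSum_zero using 1
  funext v
  by_cases hv : v ∈ chiPow G n u
  · rw [weightedShift_pow_basisVec_of_notMem hG n (u := w), inner_zero_right]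
    intro hv'
    exact h ((hG.mem_chiPow.1 hv).1.symm.trans (hG.mem_chiPow.1 hv').1)
  · rw [weightedShift_pow_basisVec_of_notMem hG n hv, inner_zero_left]

variable (hc : ‖weightedShift G lam hb‖ ≤ 1)
include hc

lemma tendsto_alphaSum (u : V) :
    Tendsto (fun n => alphaSum G lam n u) atTop (𝓝 (alpha G lam u)) := by
  refine tendsto_nhds_limUnder ⟨_, (tendsto_norm_sq_orbit_re _ hc (basisVec u)).congr fun n => ?_⟩
  rw [alphaSum_eq hG hb]

lemma alpha_nonneg (u : V) : 0 ≤ alpha G lam u :=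
  ge_of_tendsto' (tendsto_alphaSum hG hc u) fun n => by rw [alphaSum_eq hG hb]; positivity

lemma asymptoticLimit_basisVec (u : V) :
    asymptoticLimit (weightedShift G lam hb) hc (basisVec u) =
      (alpha G lam u : ℂ) • basisVec u := by
  refine tendsto_nhds_unique (asymptoticLimit_spec _ hc (basisVec u)) ?_
  have h1 : Tendsto (fun n => (alphaSum G lam n u : ℂ) • (basisVec u : Ell2 V)) atTop
      (𝓝 ((alpha G lam u : ℂ) • basisVec u)) :=
    ((Complex.continuous_ofReal.tendsto _).comp (tendsto_alphaSum hG hc u)).smul_const _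
  refine h1.congr fun n => ?_
  ext w
  rw [← inner_basisVec_left w (((ContinuousLinearMap.adjoint _) ^ n) _), adjoint_pow',
    ContinuousLinearMap.adjoint_inner_right, lp.coeFn_smul, Pi.smul_apply, basisVec_apply]
  split_ifs with h
  · rw [h, inner_self_eq_norm_sq_to_K, alphaSum_eq hG hb]
    simp
  · rw [inner_pow_basisVec_of_ne hG n h, smul_zero]

/-- Self-adjointness moves `A^{1/2}` onto the basis vector, which is an eigenvector. -/
lemma asymptoteMap_coord (f : Ell2 V) (u : V) :
    (asymptoteMap (weightedShift G lam hb) hc f : Ell2 V) u =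
      ((√(alpha G lam u) : ℝ) : ℂ) * f u := by
  rw [← inner_basisVec_left, ← asymptoteMap_selfAdjoint,
    asymptoteMap_of_eigenvector hc (alpha_nonneg hG hc u) (asymptoticLimit_basisVec hG hc u),
    inner_smul_left, inner_basisVec_left, Complex.conj_ofReal]

lemma mem_stableSubspace_iff_coord (f : Ell2 V) :
    f ∈ stableSubspace (weightedShift G lam hb) ↔ ∀ u, 0 < alpha G lam u → f u = 0 := by
  rw [mem_stableSubspace_iff_asymptoteMap hc]
  constructor
  · intro h u hu
    have h1 := asymptoteMap_coord hG hc f u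
    rw [h] at h1
    have h2 : ((√(alpha G lam u) : ℝ) : ℂ) ≠ 0 := by
      exact_mod_cast (Real.sqrt_pos.2 hu).ne'
    exact (mul_eq_zero.1 h1.symm).resolve_left h2
  · intro h
    ext u
    rw [asymptoteMap_coord hG hc]
    rcases (alpha_nonneg hG hc u).eq_or_lt with h0 | h0
    · rw [← h0]
      simp
    · rw [h u h0, mul_zero]
      rfl

lemma mem_coreSet_iff (v : V) : v ∈ coreSet G lam hb ↔ 0 < alpha G lam v := by
  change basisVec v ∈ (stableSubspace (weightedShift G lam hb))ᗮ ↔ _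
  rw [Submodule.mem_orthogonal']
  constructor
  · intro h
    by_contra h0
    have h1 : basisVec v ∈ stableSubspace (weightedShift G lam hb) := by
      rw [mem_stableSubspace_iff_coord hG hc]
      intro u hu
      rw [basisVec_apply, if_neg]
      rintro rfl
      exact h0 hu
    have h2 := norm_basisVec v
    rw [inner_self_eq_zero.1 (h _ h1), norm_zero] at h2
    exact zero_ne_one h2
  · intro h f hf
    rw [inner_basisVec_left]
    exact (mem_stableSubspace_iff_coord hG hc f).1 hf v h

lemma stableSubspace_eq : stableSubspace (weightedShift G lam hb) =
    ell2Sub (coreSet G lam hb)ᶜ := by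
  ext f
  rw [mem_ell2Sub, mem_stableSubspace_iff_coord hG hc]
  simp only [Set.mem_compl_iff, not_not, mem_coreSet_iff hG hc]

lemma stableSubspace_orthogonal_eq : (stableSubspace (weightedShift G lam hb))ᗮ =
    ell2Sub (coreSet G lam hb) := by
  ext f
  rw [mem_ell2Sub, Submodule.mem_orthogonal]
  constructor
  · intro h v hv
    rw [← inner_basisVec_left]
    refine h _ ?_
    rw [stableSubspace_eq hG hc, mem_ell2Sub]
    intro w hw
    rw [basisVec_apply, if_neg]
    rintro rfl
    exact hw hv
  · intro h g hg
    refine (lp.hasSum_inner (𝕜 := ℂ) g f).unique ?_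
    convert hasSum_zero using 1
    funext v
    by_cases hv : v ∈ coreSet G lam hb
    · rw [stableSubspace_eq hG hc, mem_ell2Sub] at hg
      rw [hg v (by simpa using hv), inner_zero_left]
    · rw [h v hv, inner_zero_right]

/-- This is Parseval for `A^{1/2} S e_u`, whose norm equals that of `A^{1/2} e_u`, namely `√(alpha
u)`. The structure of `V'` and the isometry property of `β` rest on this recursion. -/
lemma hasSum_alpha (u : V) : HasSum (fun v : chi G u => lam v ^ 2 * alpha G lam v)
    (alpha G lam u) := by
  set R := fun f => (asymptoteMap (weightedShift G lam hb) hc f : Ell2 V) with hR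
  have h1 := hasSum_norm_sq (R (weightedShift G lam hb (basisVec u)))
  have h2 : ‖R (weightedShift G lam hb (basisVec u))‖ = ‖R (basisVec u)‖ :=
    asymptoteMap_norm_comp _ hc (basisVec u)
  have h3 : ‖R (basisVec u)‖ ^ 2 = alpha G lam u := by
    rw [hR]
    simp only
    rw [asymptoteMap_of_eigenvector hc (alpha_nonneg hG hc u) (asymptoticLimit_basisVec hG hc u),
      norm_smul, norm_basisVec, mul_one, Complex.norm_real, Real.norm_eq_abs, sq_abs,
      Real.sq_sqrt (alpha_nonneg hG hc u)]
  rw [h2, h3] at h1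
  rw [← hasSum_subtype_iff_of_support_subset (s := chi G u)] at h1
  · convert h1 using 1
    funext v
    have hv : G.Adj u v.1 := v.2
    rw [Function.comp_apply, hR, asymptoteMap_coord hG hc, weightedShift_coord,
      basisVec_apply, hG.par_eq hv, if_pos rfl, mul_one,
      effWeight_of_not_isRoot (not_isRoot_iff.2 ⟨u, hv⟩), norm_mul, Complex.norm_real,
      Complex.norm_real, mul_pow, Real.norm_eq_abs, Real.norm_eq_abs, sq_abs, sq_abs,
      Real.sq_sqrt (alpha_nonneg hG hc v), mul_comm]
  · intro v hv
    by_contra hv'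
    apply hv
    change ¬ G.Adj u v at hv'
    simp only [hR]
    rw [asymptoteMap_coord hG hc, weightedShift_coord, basisVec_apply]
    by_cases hr : IsRoot G v
    · simp [effWeight_of_isRoot hr]
    · rw [if_neg]
      · simp
      · rintro rfl
        exact hv' (adj_par_of_not_isRoot hr)

variable (hpos : ∀ u v, G.Adj u v → 0 < lam v)
include hpos

/-- One positive term in the recursion makes `alpha` positive at the parent. -/
lemma par_mem_coreSet {v : V} (h : v ∈ coreSet G lam hb) : par G v ∈ coreSet G lam hb := by
  by_cases hr : IsRoot G v
  · rwa [par_eq_self_of_isRoot hr]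
  rw [mem_coreSet_iff hG hc] at h ⊢
  have hv := adj_par_of_not_isRoot hr
  have h1 := le_hasSum (hasSum_alpha hG hc (par G v)) ⟨v, hv⟩
    fun w _ => mul_nonneg (sq_nonneg _) (alpha_nonneg hG hc w.1)
  exact (mul_pos (pow_pos (hpos _ _ hv) 2) h).trans_le h1

lemma coreTree_isDirectedTree : IsDirectedTree (coreTree G lam hb) :=
  hG.inducedGraph fun _ h => par_mem_coreSet hG hc hpos h

omit hpos in
lemma coreTree_isLeafless : IsLeafless (coreTree G lam hb) := by
  intro u
  by_contra h
  have h1 : HasSum (fun v : chi G u.1 => lam v ^ 2 * alpha G lam v) 0 := by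
    convert hasSum_zero using 1
    funext v
    rcases (alpha_nonneg hG hc v.1).eq_or_lt with h0 | h0
    · rw [← h0, mul_zero]
    · exact absurd ⟨⟨v.1, (mem_coreSet_iff hG hc _).2 h0⟩, v.2⟩ h
  have h2 := (mem_coreSet_iff hG hc _).1 u.2
  rw [(hasSum_alpha hG hc u.1).unique h1] at h2
  exact h2.false

lemma isRoot_coreTree_iff (v : coreSet G lam hb) : IsRoot (coreTree G lam hb) v ↔ IsRoot G v.1 := by
  constructor
  · intro h u hu
    have := par_mem_coreSet hG hc hpos v.2
    rw [hG.par_eq hu] at this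
    exact h ⟨u, this⟩ hu
  · intro h u hu
    exact h u.1 hu

lemma coe_par_coreTree (v : coreSet G lam hb) :
    ((par (coreTree G lam hb) v : coreSet G lam hb) : V) = par G v := by
  by_cases hr : IsRoot G v.1
  · rw [par_eq_self_of_isRoot hr,
      par_eq_self_of_isRoot ((isRoot_coreTree_iff hG hc hpos v).2 hr)]
  · have h := adj_par_of_not_isRoot (mt (isRoot_coreTree_iff hG hc hpos v).1 hr)
    exact (hG.par_eq (show G.Adj ((par (coreTree G lam hb) v : coreSet G lam hb) : V) v from h)).symm

omit hpos in
-- This is the recursion for `alpha` divided by `alpha u`; children outside `V'` contribute nothing.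
lemma hasSum_coreWeight_sq (u : coreSet G lam hb) :
    HasSum (fun v : chi (coreTree G lam hb) u => |coreWeight G lam hb v| ^ 2) 1 := by
  have hu := (mem_coreSet_iff hG hc _).1 u.2
  have h1 : HasSum (fun v : chi G u.1 => lam v ^ 2 * alpha G lam v / alpha G lam u) 1 := by
    rw [← div_self hu.ne']
    exact (hasSum_alpha hG hc u.1).div_const (alpha G lam u.1)
  let φ : chi (coreTree G lam hb) u → chi G u.1 := fun v => ⟨v.1.1, v.2⟩
  have hφ : Function.Injective φ := fun v w h => by
    have h' : v.1.1 = w.1.1 := congrArg (fun x : chi G u.1 => x.1) h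
    exact Subtype.ext (Subtype.ext h')
  rw [← hφ.hasSum_iff] at h1
  · convert h1 using 1
    funext v
    have hv : G.Adj u.1 v.1.1 := v.2
    rw [Function.comp_apply, coreWeight, sq_abs, hG.par_eq hv, div_pow, mul_pow,
      Real.sq_sqrt hu.le, Real.sq_sqrt (alpha_nonneg hG hc _)]
  · intro v hv
    rcases (alpha_nonneg hG hc v.1).eq_or_lt with h0 | h0
    · rw [← h0, mul_zero, zero_div]
    · exact absurd ⟨⟨⟨v.1, (mem_coreSet_iff hG hc _).2 h0⟩, v.2⟩, rfl⟩ hv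

omit hpos in
lemma boundedWeights_coreWeight : BoundedWeights (coreTree G lam hb) (coreWeight G lam hb) := by
  refine ⟨fun u => (hasSum_coreWeight_sq hG hc u).summable, 1, ?_⟩
  rintro _ ⟨u, rfl⟩
  simp only
  rw [(hasSum_coreWeight_sq hG hc u).tsum_eq, Real.sqrt_one]

lemma coreWeight_pos {v : coreSet G lam hb} (h : ¬ IsRoot (coreTree G lam hb) v) :
    0 < coreWeight G lam hb v := by
  rw [isRoot_coreTree_iff hG hc hpos] at h
  refine div_pos (mul_pos (hpos _ _ (adj_par_of_not_isRoot h)) ?_) ?_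
  · exact Real.sqrt_pos.2 ((mem_coreSet_iff hG hc _).1 v.2)
  · exact Real.sqrt_pos.2 ((mem_coreSet_iff hG hc _).1 (par_mem_coreSet hG hc hpos v.2))

omit hpos in
/-- Extension by zero as a unitary operator onto the orthocomplement of the stable subspace. -/
lemma exists_coreEquiv : ∃ J : Ell2 (coreSet G lam hb) ≃ₗᵢ[ℂ]
    (stableSubspace (weightedShift G lam hb))ᗮ,
    ∀ f, (J f : Ell2 V) = ell2Incl (coreSet G lam hb) f := by
  have hmem : ∀ f, ell2Incl (coreSet G lam hb) f ∈ (stableSubspace (weightedShift G lam hb))ᗮ := by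
    intro f
    rw [stableSubspace_orthogonal_eq hG hc, mem_ell2Sub]
    intro v hv
    refine ell2Map_apply_of_notMem _ _ _ _ ?_
    rintro ⟨w, rfl⟩
    exact hv w.2
  let J₀ : Ell2 (coreSet G lam hb) →ₗᵢ[ℂ] (stableSubspace (weightedShift G lam hb))ᗮ :=
    { toLinearMap := (ell2Incl (coreSet G lam hb)).toLinearMap.codRestrict _ hmem
      norm_map' := fun f => (ell2Incl (coreSet G lam hb)).norm_map f }
  refine ⟨LinearIsometryEquiv.ofSurjective J₀ fun g => ?_, fun f => rfl⟩
  have hsum := (hasSum_norm_sq (g : Ell2 V)).summable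
  have hm : Memℓp (fun v : coreSet G lam hb => (g : Ell2 V) v) 2 := by
    apply memℓp_gen
    have : Summable fun v : coreSet G lam hb => ‖(g : Ell2 V) v‖ ^ 2 :=
      hsum.comp_injective Subtype.val_injective
    simpa using this
  refine ⟨⟨_, hm⟩, Subtype.ext ?_⟩
  change ell2Incl (coreSet G lam hb) ⟨_, hm⟩ = (g : Ell2 V)
  ext v
  by_cases hv : v ∈ coreSet G lam hb
  · exact ell2Map_apply Subtype.val Subtype.val_injective ⟨_, hm⟩ ⟨v, hv⟩
  · have hg : (g : Ell2 V) ∈ ell2Sub (coreSet G lam hb) :=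
      (stableSubspace_orthogonal_eq hG hc).le g.2
    rw [mem_ell2Sub.1 hg v hv]
    refine ell2Map_apply_of_notMem _ _ _ _ ?_
    rintro ⟨w, rfl⟩
    exact hv w.2

lemma isometricAsymptote_coreEquiv
    (hβ : BoundedWeights (coreTree G lam hb) (coreWeight G lam hb))
    (J : Ell2 (coreSet G lam hb) ≃ₗᵢ[ℂ] (stableSubspace (weightedShift G lam hb))ᗮ)
    (hJ : ∀ f, (J f : Ell2 V) = ell2Incl (coreSet G lam hb) f) (f : Ell2 (coreSet G lam hb)) :
    isometricAsymptote (weightedShift G lam hb) hc (J f) =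
      J (weightedShift (coreTree G lam hb) (coreWeight G lam hb) hβ f) := by
  have hJv : ∀ f (v : coreSet G lam hb), (J f : Ell2 V) v = f v := fun f v => by
    rw [hJ]
    exact ell2Map_apply Subtype.val Subtype.val_injective f v
  -- Passing to `y = J f` allows a density argument: it suffices to take `y = A^{1/2} g`, where the
  -- intertwining relation computes the left side. Both sides then have the coordinate `lam v *
  -- √(alpha v) * g (par v)`.
  suffices h : ∀ y, isometricAsymptote (weightedShift G lam hb) hc y =
      J (weightedShift (coreTree G lam hb) (coreWeight G lam hb) hβ (J.symm y)) by
    rw [h, J.symm_apply_apply]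
  intro y
  refine (asymptoteMap_denseRange (weightedShift G lam hb) hc).induction_on
    (p := fun y => isometricAsymptote (weightedShift G lam hb) hc y =
      J (weightedShift (coreTree G lam hb) (coreWeight G lam hb) hβ (J.symm y))) y
    (isClosed_eq (LinearIsometry.continuous _) (by fun_prop)) fun g => ?_
  rw [← isometricAsymptote_spec, ← J.symm_apply_eq]
  ext v
  have key : ∀ x (w : coreSet G lam hb), J.symm (asymptoteMap (weightedShift G lam hb) hc x) w =
      ((√(alpha G lam w) : ℝ) : ℂ) * x w := fun x w => by
    rw [← hJv, J.apply_symm_apply]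
    exact asymptoteMap_coord hG hc x w
  rw [weightedShift_coord, key, key, weightedShift_coord, coe_par_coreTree hG hc hpos]
  by_cases hr : IsRoot G v.1
  · rw [effWeight_of_isRoot hr, effWeight_of_isRoot ((isRoot_coreTree_iff hG hc hpos v).2 hr)]
    simp
  · rw [effWeight_of_not_isRoot hr,
      effWeight_of_not_isRoot (mt (isRoot_coreTree_iff hG hc hpos v).1 hr), coreWeight]
    have h0 : √(alpha G lam (par G v)) ≠ 0 :=
      (Real.sqrt_pos.2 ((mem_coreSet_iff hG hc _).1 (par_mem_coreSet hG hc hpos v.2))).ne'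
    have h0' : ((√(alpha G lam (par G v)) : ℝ) : ℂ) ≠ 0 := by exact_mod_cast h0
    push_cast
    field_simp

end

end Core

/-! ### Wold decomposition of an isometry. -/

section Wold

variable {H : Type*} [NormedAddCommGroup H] [InnerProductSpace ℂ H]
  {K : Type*} [NormedAddCommGroup K] [InnerProductSpace ℂ K]

lemma UnitarilyEquivalent.of_hilbertBasis {ι : Type*} {T : H →L[ℂ] H} {T' : K →L[ℂ] K}
    (b : HilbertBasis ι ℂ H) (b' : HilbertBasis ι ℂ K) (σ : ι → ι)
    (hT : ∀ i, T (b i) = b (σ i)) (hT' : ∀ i, T' (b' i) = b' (σ i)) :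
    UnitarilyEquivalent T T' := by
  classical
  let W : H ≃ₗᵢ[ℂ] K := b.repr.trans b'.repr.symm
  have hW : ∀ i, W (b i) = b' i := fun i => by
    change b'.repr.symm (b.repr (b i)) = b' i
    rw [b.repr_self, b'.repr_symm_single]
  refine ⟨W, fun x => ?_⟩
  have h : (W.toContinuousLinearEquiv : H →L[ℂ] K) ∘L T =
      T' ∘L (W.toContinuousLinearEquiv : H →L[ℂ] K) := by
    refine ContinuousLinearMap.ext_on
      (Submodule.dense_iff_topologicalClosure_eq_top.2 b.dense_span) ?_
    rintro _ ⟨i, rfl⟩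
    change W (T (b i)) = T' (W (b i))
    rw [hT, hW, hW, hT']
  exact congrArg (fun F : H →L[ℂ] K => F x) h

lemma UnitarilyEquivalent.trans {L : Type*} [NormedAddCommGroup L] [InnerProductSpace ℂ L]
    {T : H →L[ℂ] H} {T' : K →L[ℂ] K} {T'' : L →L[ℂ] L} (h : UnitarilyEquivalent T T')
    (h' : UnitarilyEquivalent T' T'') : UnitarilyEquivalent T T'' := by
  obtain ⟨W, hW⟩ := h
  obtain ⟨W', hW'⟩ := h'
  exact ⟨W.trans W', fun x => by simp [hW, hW']⟩

lemma exists_hilbertBasis [CompleteSpace H] {ι : Type*} {v : ι → H} (hv : Orthonormal ℂ v)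
    (h : ∀ x, (∀ i, inner ℂ (v i) x = 0) → x = 0) : ∃ b : HilbertBasis ι ℂ H, ∀ i, b i = v i := by
  refine ⟨HilbertBasis.mkOfOrthogonalEqBot hv ?_,
    fun i => congrFun (HilbertBasis.coe_mkOfOrthogonalEqBot hv _) i⟩
  rw [Submodule.eq_bot_iff]
  intro x hx
  exact h x fun i => (Submodule.mem_orthogonal _ _).1 hx _ (Submodule.subset_span ⟨i, rfl⟩)

/-- The vectors that lie in the range of every power of an operator. -/
def inPowRanges (U : H →L[ℂ] H) : Set H := {f | ∀ n : ℕ, ∃ g, (U ^ n) g = f}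

section Isometry

variable {U : H →L[ℂ] H} (hU : ∀ x, ‖U x‖ = ‖x‖)
include hU

lemma inner_isometry (x y : H) : inner ℂ (U x) (U y) = inner ℂ x y :=
  LinearIsometry.inner_map_map (⟨U.toLinearMap, hU⟩ : H →ₗᵢ[ℂ] H) x y

lemma norm_isometry_pow (n : ℕ) (x : H) : ‖(U ^ n) x‖ = ‖x‖ := by
  induction n with
  | zero => rfl
  | succ n ih => rw [pow_succ']; exact (hU _).trans ih

lemma inner_isometry_pow (n : ℕ) (x y : H) : inner ℂ ((U ^ n) x) ((U ^ n) y) = inner ℂ x y :=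
  inner_isometry (norm_isometry_pow hU n) x y

lemma isometry_injective : Function.Injective U :=
  LinearIsometry.injective (⟨U.toLinearMap, hU⟩ : H →ₗᵢ[ℂ] H)

lemma exists_mem_inPowRanges {f : H} (hf : f ∈ inPowRanges U) : ∃ g ∈ inPowRanges U, U g = f := by
  obtain ⟨g, hg⟩ := hf 1
  rw [pow_one] at hg
  refine ⟨g, fun n => ?_, hg⟩
  obtain ⟨g', hg'⟩ := hf (n + 1)
  refine ⟨g', isometry_injective hU ?_⟩
  rw [hg, ← hg', pow_succ']
  rfl

/-- The intersection of the ranges of the powers is the largest reducing subspace on which an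
isometry is unitary: it reduces because `U* U = 1`, and any subspace that `U` maps onto itself lies
in it. -/
lemma isCNU_iff_of_isometry [CompleteSpace H] : IsCNU U ↔ ∀ f ∈ inPowRanges U, f = 0 := by
  constructor
  · intro h
    let M : Submodule ℂ H := ⨅ n : ℕ, LinearMap.range (U ^ n).toLinearMap
    have hM : ∀ f, f ∈ M ↔ f ∈ inPowRanges U := fun f => by
      rw [Submodule.mem_iInf]
      rfl
    have hadj : ∀ x, ContinuousLinearMap.adjoint U (U x) = x := fun x => by
      refine ext_inner_right ℂ fun y => ?_
      rw [ContinuousLinearMap.adjoint_inner_left, inner_isometry hU]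
    have := h M ?_ ?_ ?_ (fun x _ => hU x) ?_
    · intro f hf
      rw [← hM, this] at hf
      exact hf
    · have : (M : Set H) = ⋂ n : ℕ, Set.range (U ^ n) := by
        ext f
        simp only [SetLike.mem_coe, hM, Set.mem_iInter]
        rfl
      rw [this]
      refine isClosed_iInter fun n => ?_
      exact (LinearIsometry.isometry (⟨(U ^ n).toLinearMap, norm_isometry_pow hU n⟩ :
        H →ₗᵢ[ℂ] H)).isClosedEmbedding.isClosed_range
    · intro x hx
      rw [hM] at hx ⊢
      intro n
      obtain ⟨g, hg⟩ := hx n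
      refine ⟨U g, ?_⟩
      rw [← hg]
      change (U ^ n * U) g = (U * U ^ n) g
      rw [← pow_succ, ← pow_succ']
    · intro x hx
      rw [hM] at hx ⊢
      obtain ⟨g, hg, rfl⟩ := exists_mem_inPowRanges hU hx
      rwa [hadj]
    · intro y hy
      obtain ⟨g, hg, h'⟩ := exists_mem_inPowRanges hU ((hM y).1 hy)
      exact ⟨g, (hM g).2 hg, h'⟩
  · intro h M _ _ _ _ hsurj
    rw [Submodule.eq_bot_iff]
    have key : ∀ (n : ℕ), ∀ y ∈ M, ∃ x ∈ M, (U ^ n) x = y := by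
      intro n
      induction n with
      | zero => exact fun y hy => ⟨y, hy, rfl⟩
      | succ n ih =>
        intro y hy
        obtain ⟨x, hx, rfl⟩ := ih y hy
        obtain ⟨w, hw, rfl⟩ := hsurj x hx
        exact ⟨w, hw, by rw [pow_succ]; rfl⟩
    intro y hy
    refine h y fun n => ?_
    obtain ⟨x, -, hx⟩ := key n y hy
    exact ⟨x, hx⟩

variable {N : Type*} {z : N → H} (hz : Orthonormal ℂ z) (hzU : ∀ v f, inner ℂ (z v) (U f) = 0)

section
include hz hzU

/-- Cancelling the smaller power leaves a wandering vector paired with a vector in the range of `U`.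
-/
lemma orthonormal_pow_wandering : Orthonormal ℂ fun p : N × ℕ => (U ^ p.2) (z p.1) := by
  refine ⟨fun p => by rw [norm_isometry_pow hU, hz.1], ?_⟩
  have hlt : ∀ (v w : N) (k l : ℕ), k < l → inner ℂ ((U ^ k) (z v)) ((U ^ l) (z w)) = 0 := by
    intro v w k l hkl
    obtain ⟨d, rfl⟩ := Nat.exists_eq_add_of_lt hkl
    rw [add_assoc, pow_add]
    change inner ℂ ((U ^ k) (z v)) ((U ^ k) ((U ^ (d + 1)) (z w))) = 0
    rw [inner_isometry_pow hU, pow_succ']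
    exact hzU _ _
  rintro ⟨v, k⟩ ⟨w, l⟩ hne
  simp only
  rcases lt_trichotomy k l with h | h | h
  · exact hlt v w k l h
  · subst h
    rw [inner_isometry_pow hU]
    exact hz.2 fun h => hne (by rw [h])
  · rw [← inner_conj_symm, hlt w v l k h, map_zero]

end

section
variable (hran : ∀ f, (∀ v, inner ℂ (z v) f = 0) → ∃ g, U g = f)
include hran

/-- Orthogonality to the `z v` gives `f = U g`, and `g` inherits the whole hypothesis because `U`
preserves inner products; iterate. -/
lemma mem_inPowRanges_of_inner_eq_zero {f : H}
    (hf : ∀ p : N × ℕ, inner ℂ ((U ^ p.2) (z p.1)) f = 0) :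
    f ∈ inPowRanges U := by
  intro n
  induction n generalizing f with
  | zero => exact ⟨f, rfl⟩
  | succ n ih =>
    obtain ⟨g, rfl⟩ := hran f fun v => hf (v, 0)
    have hg : ∀ p : N × ℕ, inner ℂ ((U ^ p.2) (z p.1)) g = 0 := by
      rintro ⟨v, k⟩
      have := hf (v, k + 1)
      simp only [pow_succ'] at this
      exact (inner_isometry hU _ _).symm.trans this
    obtain ⟨g', hg'⟩ := ih hg
    refine ⟨g', ?_⟩
    rw [pow_succ', ← hg']
    rfl

include hz hzU

/-- Wold decomposition of a pure isometry. -/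
lemma exists_wold_basis [CompleteSpace H] (hpure : ∀ f ∈ inPowRanges U, f = 0) :
    ∃ b : HilbertBasis (N × ℕ) ℂ H, ∀ p, b p = (U ^ p.2) (z p.1) :=
  exists_hilbertBasis (orthonormal_pow_wandering hU hz hzU) fun f hf =>
    hpure f (mem_inPowRanges_of_inner_eq_zero hU hran hf)

/-- Wold decomposition of an isometry whose unitary part is a bilateral shift. -/
lemma exists_wold_basis_sum [CompleteSpace H] {x : ℤ → H} (hx : Orthonormal ℂ x)
    (hxU : ∀ m, U (x m) = x (m + 1))
    (hcompl : ∀ f ∈ inPowRanges U, (∀ m, inner ℂ (x m) f = 0) → f = 0) :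
    ∃ b : HilbertBasis (ℤ ⊕ N × ℕ) ℂ H,
      ∀ p, b p = Sum.elim x (fun p : N × ℕ => (U ^ p.2) (z p.1)) p := by
  have hxp : ∀ (n : ℕ) m, (U ^ n) (x m) = x (m + n) := by
    intro n
    induction n with
    | zero => intro m; simp
    | succ n ih =>
      intro m
      rw [pow_succ']
      change U ((U ^ n) (x m)) = _
      rw [ih, hxU]
      congr 1
      push_cast
      ring
  -- Writing `x m = U ^ (k + 1) (x (m - (k + 1)))` and cancelling `U ^ k` leaves a vector in the
  -- range of `U`.
  have h0 : ∀ (p : N × ℕ) m, inner ℂ ((U ^ p.2) (z p.1)) (x m) = 0 := by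
    rintro ⟨v, k⟩ m
    have h1 := hxp (k + 1) (m - (k + 1 : ℕ))
    rw [sub_add_cancel] at h1
    rw [← h1, pow_succ]
    exact (inner_isometry_pow hU _ _ _).trans (hzU _ _)
  have ho := orthonormal_pow_wandering hU hz hzU
  refine exists_hilbertBasis ⟨?_, ?_⟩ fun f hf => ?_
  · rintro (m | p)
    · exact hx.1 m
    · exact ho.1 p
  · rintro (m | p) (m' | p') hne
    · exact hx.2 fun h => hne (by rw [h])
    · change inner ℂ (x m) ((U ^ p'.2) (z p'.1)) = 0
      rw [← inner_conj_symm, h0, map_zero]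
    · exact h0 p m'
    · exact ho.2 fun h => hne (by rw [h])
  · exact hcompl f (mem_inPowRanges_of_inner_eq_zero hU hran fun p => hf (Sum.inr p))
      fun m => hf (Sum.inl m)

end

end Isometry

end Wold

/-! ### Comparison with the simple shifts. -/

section Models

open Classical in
lemma ell2Map_basisVec {ι κ : Type*} (φ : ι → κ) (hφ : Function.Injective φ) (i : ι) :
    ell2Map φ hφ (basisVec i) = basisVec (φ i) := by
  ext k
  rw [basisVec_apply]
  by_cases h : ∃ j, φ j = k
  · obtain ⟨j, rfl⟩ := h
    rw [ell2Map_apply, basisVec_apply]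
    simp [hφ.eq_iff]
  · rw [ell2Map_apply_of_notMem _ _ _ _ h, if_neg]
    rintro rfl
    exact h ⟨i, rfl⟩

lemma orthonormal_basisVec {ι : Type*} : Orthonormal ℂ (basisVec : ι → Ell2 ι) := by
  refine ⟨norm_basisVec, fun i j h => ?_⟩
  change inner ℂ (basisVec i) (basisVec j) = 0
  rw [inner_basisVec_left, basisVec_apply, if_neg h]

lemma eq_zero_of_inner_basisVec {ι : Type*} {f : Ell2 ι} (h : ∀ i, inner ℂ (basisVec i) f = 0) :
    f = 0 := by
  ext i
  rw [← inner_basisVec_left, h]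
  rfl

/-- The standard basis of the direct sum of copies of the square summable functions. -/
noncomputable def copiesVec {n : ℕ∞} (p : IndexSet n × ℕ) : Ell2Copies n :=
  lp.single 2 p.1 (basisVec p.2)

lemma inner_copiesVec_left {n : ℕ∞} (p : IndexSet n × ℕ) (f : Ell2Copies n) :
    inner ℂ (copiesVec p) f = (f p.1) p.2 := by
  rw [copiesVec, lp.inner_single_left, inner_basisVec_left]

lemma orthonormal_copiesVec {n : ℕ∞} :
    Orthonormal ℂ (copiesVec : IndexSet n × ℕ → Ell2Copies n) := by
  refine ⟨fun p => ?_, fun p q h => ?_⟩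
  · rw [copiesVec, lp.norm_single (by norm_num), norm_basisVec]
  · change inner ℂ (copiesVec p) (copiesVec q) = 0
    rw [inner_copiesVec_left, copiesVec, lp.single_apply]
    by_cases h1 : p.1 = q.1
    · have h2 : p.2 ≠ q.2 := fun h2 => h (Prod.ext h1 h2)
      rw [h1, Pi.single_eq_same, basisVec_apply, if_neg h2]
    · rw [Pi.single_eq_of_ne h1]
      rfl

lemma eq_zero_of_inner_copiesVec {n : ℕ∞} {f : Ell2Copies n}
    (h : ∀ p, inner ℂ (copiesVec p) f = 0) : f = 0 := by
  ext i k
  rw [← inner_copiesVec_left (i, k), h]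
  rfl

lemma unilateralShiftMult_copiesVec {n : ℕ∞} (p : IndexSet n × ℕ) :
    unilateralShiftMult n (copiesVec p) = copiesVec (p.1, p.2 + 1) := by
  ext1
  funext i
  change unilateralShift ((copiesVec p : Ell2Copies n) i) = (copiesVec (p.1, p.2 + 1) : Ell2Copies n) i
  rw [copiesVec, copiesVec, lp.single_apply, lp.single_apply]
  by_cases h : i = p.1
  · subst h
    rw [Pi.single_eq_same, Pi.single_eq_same, unilateralShift, ell2Map_basisVec]
  · rw [Pi.single_eq_of_ne h, Pi.single_eq_of_ne h, map_zero]

variable {H : Type*} [NormedAddCommGroup H] [InnerProductSpace ℂ H] [CompleteSpace H]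
  {U : H →L[ℂ] H} (hU : ∀ x, ‖U x‖ = ‖x‖)
  {N : Type*} {z : N → H} (hz : Orthonormal ℂ z) (hzU : ∀ v f, inner ℂ (z v) (U f) = 0)
  (hran : ∀ f, (∀ v, inner ℂ (z v) f = 0) → ∃ g, U g = f)
include hU hz hzU hran

/-- Both operators act on an orthonormal basis indexed by `N × ℕ` through the same map `(v, k) ↦ (v,
k + 1)`. -/
theorem unitarilyEquivalent_unilateralShiftMult {n : ℕ∞} (e : N ≃ IndexSet n)
    (hpure : ∀ f ∈ inPowRanges U, f = 0) : UnitarilyEquivalent U (unilateralShiftMult n) := by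
  obtain ⟨b, hb⟩ := exists_wold_basis hU hz hzU hran hpure
  let ε : N × ℕ → IndexSet n × ℕ := Prod.map e id
  have hε : Function.Injective ε := e.injective.prodMap Function.injective_id
  obtain ⟨b', hb'⟩ := exists_hilbertBasis (orthonormal_copiesVec (n := n).comp ε hε) fun f hf =>
    eq_zero_of_inner_copiesVec fun p => by simpa [ε] using hf (e.symm p.1, p.2)
  refine .of_hilbertBasis b b' (fun p => (p.1, p.2 + 1)) (fun p => ?_) fun p => ?_
  · rw [hb, hb, pow_succ']
    rfl
  · rw [hb', hb']
    exact unilateralShiftMult_copiesVec _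

theorem unitarilyEquivalent_orthSum {n : ℕ∞} (e : N ≃ IndexSet n) {x : ℤ → H}
    (hx : Orthonormal ℂ x) (hxU : ∀ m, U (x m) = x (m + 1))
    (hcompl : ∀ f ∈ inPowRanges U, (∀ m, inner ℂ (x m) f = 0) → f = 0) :
    UnitarilyEquivalent U
      (orthSum bilateralShift.toContinuousLinearMap (unilateralShiftMult n)) := by
  obtain ⟨b, hb⟩ := exists_wold_basis_sum hU hz hzU hran hx hxU hcompl
  let ε : N × ℕ → IndexSet n × ℕ := Prod.map e id
  have hε : Function.Injective ε := e.injective.prodMap Function.injective_id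
  let y : ℤ ⊕ N × ℕ → WithLp 2 (Ell2 ℤ × Ell2Copies n) :=
    Sum.elim (fun m => WithLp.toLp 2 (basisVec m, 0)) fun p => WithLp.toLp 2 (0, copiesVec (ε p))
  have hy : Orthonormal ℂ y := by
    refine ⟨?_, ?_⟩
    · rintro (m | p)
      · simp [y, norm_basisVec]
      · simp [y, orthonormal_copiesVec.1]
    · rintro (m | p) (m' | p') hne
      · have : m ≠ m' := fun h => hne (by rw [h])
        simp [y, orthonormal_basisVec.2 this]
      · simp [y]
      · simp [y]
      · have : ε p ≠ ε p' := fun h => hne (by rw [hε h])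
        simp [y, orthonormal_copiesVec.2 this]
  obtain ⟨b', hb'⟩ := exists_hilbertBasis hy fun f hf => by
    have h1 : f.ofLp.1 = 0 := eq_zero_of_inner_basisVec fun m => by
      simpa [y, WithLp.prod_inner_apply] using hf (Sum.inl m)
    have h2 : f.ofLp.2 = 0 := eq_zero_of_inner_copiesVec fun p => by
      simpa [y, ε, WithLp.prod_inner_apply] using hf (Sum.inr (e.symm p.1, p.2))
    rw [← WithLp.toLp_ofLp 2 f, show f.ofLp = 0 from Prod.ext h1 h2]
    rfl
  refine .of_hilbertBasis b b' (Sum.map (fun m => m + 1) fun p => (p.1, p.2 + 1))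
    (fun p => ?_) fun p => ?_
  · rw [hb, hb]
    rcases p with m | p
    · exact hxU m
    · simp only [Sum.elim_inr, Sum.map_inr, pow_succ']
      rfl
  · rw [hb', hb']
    rcases p with m | p
    · change WithLp.toLp 2 (bilateralShift (basisVec m), unilateralShiftMult n 0) =
        WithLp.toLp 2 (basisVec (m + 1), 0)
      rw [bilateralShift, ell2Map_basisVec, map_zero]
    · change WithLp.toLp 2 (bilateralShift 0, unilateralShiftMult n (copiesVec (ε p))) =
        WithLp.toLp 2 (0, copiesVec (ε (p.1, p.2 + 1)))
      rw [map_zero, unilateralShiftMult_copiesVec]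
      rfl

end Models

/-! ### Cardinalities in `ℕ∞` and index sets. -/

section Encard

lemma encard_le_of_forall_finset {α : Type*} {s : Set α} {c : ℕ∞}
    (h : ∀ t : Finset α, ↑t ⊆ s → (t.card : ℕ∞) ≤ c) : s.encard ≤ c := by
  rcases s.finite_or_infinite with hs | hs
  · rw [hs.encard_eq_coe_toFinset_card]
    exact h _ (by simp)
  · have : c = ⊤ := by
      rw [ENat.eq_top_iff_forall_ge]
      intro n
      obtain ⟨t, ht, rfl⟩ := hs.exists_subset_card_eq n
      exact h t ht
    rw [this]
    exact le_top

open Classical in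
-- The function `p` recovers the index of a point, so the sets are disjoint and a finite set of
-- points meets only those indexed by its image under `p`.
lemma encard_iUnion_eq_iSup {α ι : Type*} (F : ι → Set α) (p : α → ι)
    (hp : ∀ i, ∀ a ∈ F i, p a = i) :
    (⋃ i, F i).encard = ⨆ s : Finset ι, ∑ i ∈ s, (F i).encard := by
  have hfin : ∀ s : Finset ι, (⋃ i ∈ s, F i).encard = ∑ i ∈ s, (F i).encard := by
    intro s
    induction s using Finset.induction_on with
    | empty => simp
    | insert i s hi ih =>
      rw [Finset.set_biUnion_insert, Set.encard_union_eq, Finset.sum_insert hi, ih]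
      rw [Set.disjoint_left]
      intro a ha ha'
      simp only [Set.mem_iUnion] at ha'
      obtain ⟨j, hj, haj⟩ := ha'
      have : i = j := (hp i a ha).symm.trans (hp j a haj)
      exact hi (this ▸ hj)
  apply le_antisymm
  · refine encard_le_of_forall_finset fun t ht => ?_
    refine le_trans ?_ (le_iSup _ (t.image p))
    rw [← hfin, ← Set.encard_coe_eq_coe_finsetCard]
    refine Set.encard_le_encard fun a ha => ?_
    obtain ⟨i, hi⟩ := Set.mem_iUnion.1 (ht ha)
    simp only [Set.mem_iUnion]
    refine ⟨p a, Finset.mem_image_of_mem _ ha, ?_⟩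
    rwa [hp i a hi]
  · refine iSup_le fun s => ?_
    rw [← hfin]
    exact Set.encard_le_encard (Set.iUnion₂_subset fun i _ => Set.subset_iUnion F i)

lemma exists_equiv_indexSet {α : Type*} [Countable α] {n : ℕ∞} (h : ENat.card α = n) :
    Nonempty (α ≃ IndexSet n) := by
  cases n with
  | top =>
    have hinf : Infinite α := ENat.card_eq_top.1 h
    have h1 : Nonempty (α ≃ ℕ) := nonempty_equiv_of_countable
    have h2 : ∀ i : ℕ, (i : ℕ∞) < ⊤ := ENat.natCast_lt_top
    exact ⟨h1.some.trans (Equiv.subtypeUnivEquiv h2).symm⟩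
  | coe k =>
    have hfin : Finite α := by
      rw [← not_infinite_iff_finite, ← ENat.card_eq_top, h]
      exact ENat.natCast_ne_top k
    have hk : Nat.card α = k := by
      rw [ENat.card_eq_coe_natCard] at h
      exact_mod_cast h
    have e1 := Finite.equivFinOfCardEq hk
    exact ⟨e1.trans (Fin.equivSubtype.trans (Equiv.subtypeEquivRight fun i => by norm_cast))⟩

end Encard

/-! ### The orthocomplement of the range of an isometric shift. -/

section IsometricShift

variable {V : Type*} {G : Digraph V}

/-- `v` comes first among its siblings in the order given by `enc`. -/
def IsFirstChild (G : Digraph V) (enc : V → ℕ) (v : V) : Prop :=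
  ¬ IsRoot G v ∧ ∀ w, G.Adj (par G v) w → enc v ≤ enc w

lemma exists_isFirstChild (hG : IsDirectedTree G) (hl : IsLeafless G) (enc : V → ℕ) (u : V) :
    ∃ v, G.Adj u v ∧ IsFirstChild G enc v := by
  obtain ⟨v, hv, hmin⟩ := WellFounded.has_min (measure enc).wf (chi G u) (hl u)
  have hv' : G.Adj u v := hv
  refine ⟨v, hv', not_isRoot_iff.2 ⟨u, hv'⟩, fun w hw => ?_⟩
  rw [hG.par_eq hv'] at hw
  exact not_lt.1 (hmin w hw)

open Classical in
/-- The number of vertices that do not come first among their siblings. -/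
lemma card_not_isFirstChild (hG : IsDirectedTree G) (hl : IsLeafless G) {enc : V → ℕ}
    (henc : Function.Injective enc) :
    ENat.card {v // ¬ IsFirstChild G enc v} =
      branchingIndex G + if HasRoot G then 1 else 0 := by
  choose fst hfst hfst' using exists_isFirstChild hG hl enc
  have huniq : ∀ u v, G.Adj u v → (IsFirstChild G enc v ↔ v = fst u) := by
    intro u v huv
    constructor
    · intro h
      refine henc (le_antisymm ?_ ?_)
      · refine h.2 _ ?_
        rw [hG.par_eq huv]
        exact hfst u
      · refine (hfst' u).2 _ ?_
        rw [hG.par_eq (hfst u)]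
        exact huv
    · rintro rfl
      exact hfst' u
  -- A vertex that is not a first child is a root or a further child of a branching vertex; the
  -- latter number `|chi u| - 1` for each branching `u`.
  have hset : {v | ¬ IsFirstChild G enc v} =
      (⋃ u : {u : V // 1 < (chi G u).encard}, chi G u.1 \ {fst u.1}) ∪ {v | IsRoot G v} := by
    ext v
    simp only [Set.mem_union, Set.mem_iUnion]
    change ¬ IsFirstChild G enc v ↔ (∃ u : {u : V // 1 < (chi G u).encard},
      G.Adj u.1 v ∧ v ≠ fst u.1) ∨ IsRoot G v
    constructor
    · intro hv
      by_cases hr : IsRoot G v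
      · exact Or.inr hr
      · have hp := adj_par_of_not_isRoot hr
        have hne : v ≠ fst (par G v) := mt (huniq _ _ hp).2 hv
        exact Or.inl ⟨⟨par G v, Set.one_lt_encard_iff.2 ⟨v, fst (par G v), hp, hfst _, hne⟩⟩,
          hp, hne⟩
    · rintro (⟨u, hu, hne⟩ | hr)
      · exact mt (huniq _ _ hu).1 hne
      · exact fun h => h.1 hr
  have hdisj : Disjoint (⋃ u : {u : V // 1 < (chi G u).encard}, chi G u.1 \ {fst u.1})
      {v | IsRoot G v} := by
    rw [Set.disjoint_left]
    intro v hv hr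
    obtain ⟨u, hu, -⟩ := Set.mem_iUnion.1 hv
    exact hr u.1 hu
  have hroot : {v | IsRoot G v}.encard = if HasRoot G then 1 else 0 := by
    split_ifs with h
    · obtain ⟨r, hr⟩ := h
      rw [Set.encard_eq_one]
      exact ⟨r, Set.eq_singleton_iff_unique_mem.2 ⟨hr, fun v hv => hG.isRoot_unique hv hr⟩⟩
    · rw [Set.encard_eq_zero, Set.eq_empty_iff_forall_notMem]
      exact fun v hv => h ⟨v, hv⟩
  change ENat.card ({v | ¬ IsFirstChild G enc v} : Set V) = _
  rw [ENat.card_coe_set_eq, hset, Set.encard_union_eq hdisj, hroot]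
  congr 1
  have hF : (⋃ u : {u : V // 1 < (chi G u).encard}, chi G u.1 \ {fst u.1}).encard =
      ⨆ s : Finset {u : V // 1 < (chi G u).encard}, ∑ u ∈ s, (chi G u.1 \ {fst u.1}).encard := by
    rcases isEmpty_or_nonempty {u : V // 1 < (chi G u).encard} with he | ⟨⟨u₀⟩⟩
    · have : ∀ s : Finset {u : V // 1 < (chi G u).encard}, s = ∅ := fun s =>
        Finset.eq_empty_of_isEmpty s
      simp [this]
    · refine encard_iUnion_eq_iSup _
        -- The value `u₀` is never used: every point of the union has a branching parent.
        (fun v => if h : 1 < (chi G (par G v)).encard then ⟨par G v, h⟩ else u₀) fun u v hv => ?_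
      have hp : par G v = u.1 := hG.par_eq hv.1
      have h1 : 1 < (chi G (par G v)).encard := by rw [hp]; exact u.2
      rw [dif_pos h1]
      exact Subtype.ext hp
  rw [hF, branchingIndex]
  refine iSup_congr fun s => Finset.sum_congr rfl fun u _ => ?_
  exact Set.encard_sdiff_singleton_of_mem (hfst u.1)

variable {lam : V → ℝ} {hb : BoundedWeights G lam}

open Classical in
lemma weightedShift_basisVec_coord (hG : IsDirectedTree G) (u v : V) :
    weightedShift G lam hb (basisVec u) v = if G.Adj u v then (lam v : ℂ) else 0 := by
  rw [weightedShift_coord, basisVec_apply]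
  by_cases h : G.Adj u v
  · rw [if_pos h, if_pos (hG.par_eq h), effWeight_of_not_isRoot (not_isRoot_iff.2 ⟨u, h⟩), mul_one]
  · rw [if_neg h]
    by_cases hr : IsRoot G v
    · simp [effWeight_of_isRoot hr]
    · rw [if_neg, mul_zero]
      rintro rfl
      exact h (adj_par_of_not_isRoot hr)

lemma weightedShift_coord_of_adj (hG : IsDirectedTree G) (f : Ell2 V) {u v : V} (h : G.Adj u v) :
    weightedShift G lam hb f v = (lam v : ℂ) * f u := by
  rw [weightedShift_coord, hG.par_eq h, effWeight_of_not_isRoot (not_isRoot_iff.2 ⟨u, h⟩)]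

lemma weightedShift_coord_of_isRoot (f : Ell2 V) {v : V} (h : IsRoot G v) :
    weightedShift G lam hb f v = 0 := by
  rw [weightedShift_coord, effWeight_of_isRoot h]
  simp

lemma inner_weightedShift_basisVec (hG : IsDirectedTree G) (u : V) (f : Ell2 V) :
    HasSum (fun v : chi G u => (lam v : ℂ) * f v)
      (inner ℂ (weightedShift G lam hb (basisVec u)) f) := by
  have h1 := lp.hasSum_inner (𝕜 := ℂ) (weightedShift G lam hb (basisVec u)) f
  rw [← hasSum_subtype_iff_of_support_subset (s := chi G u)] at h1
  · refine Eq.subst (motive := fun F => HasSum F _) (funext fun v => Eq.symm ?_) h1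
    have hv : G.Adj u v.1 := v.2
    rw [Function.comp_apply, weightedShift_basisVec_coord hG, if_pos hv, RCLike.inner_apply,
      mul_comm]
    congr 1
    exact (Complex.conj_ofReal _).symm
  · intro v hv
    by_contra hv'
    apply hv
    change ¬ G.Adj u v at hv'
    simp only
    rw [weightedShift_basisVec_coord hG, if_neg hv', inner_zero_left]

open Classical in
/-- The siblings of `v` that precede it in the order given by `enc`. -/
noncomputable def precSibs (G : Digraph V) {enc : V → ℕ} (henc : Function.Injective enc) (v : V) :
    Finset V :=
  ((Finset.range (enc v)).preimage enc henc.injOn).filter fun w => G.Adj (par G v) w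

lemma mem_precSibs {enc : V → ℕ} {henc : Function.Injective enc} {v w : V} :
    w ∈ precSibs G henc v ↔ enc w < enc v ∧ G.Adj (par G v) w := by
  simp [precSibs]

open Classical in
/-- Vectors orthogonal to the range of the weighted shift; those at vertices that do not come
first among their siblings form an orthogonal basis of the orthocomplement of the range. -/
noncomputable def wanderVec (G : Digraph V) (lam : V → ℝ) {enc : V → ℕ}
    (henc : Function.Injective enc) (v : V) : Ell2 V :=
  if IsRoot G v then basisVec v else
    (lam v : ℂ) • ∑ w ∈ precSibs G henc v, (lam w : ℂ) • basisVec w -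
      (∑ w ∈ precSibs G henc v, (lam w : ℂ) ^ 2) • basisVec v

variable {enc : V → ℕ} {henc : Function.Injective enc}

lemma inner_wanderVec_of_isRoot {v : V} (h : IsRoot G v) (f : Ell2 V) :
    inner ℂ (wanderVec G lam henc v) f = f v := by
  rw [wanderVec, if_pos h, inner_basisVec_left]

lemma inner_wanderVec {v : V} (h : ¬ IsRoot G v) (f : Ell2 V) :
    inner ℂ (wanderVec G lam henc v) f =
      lam v * ∑ w ∈ precSibs G henc v, (lam w : ℂ) * f w -
        (∑ w ∈ precSibs G henc v, (lam w : ℂ) ^ 2) * f v := by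
  rw [wanderVec, if_neg h, inner_sub_left, inner_smul_left, inner_smul_left, sum_inner,
    inner_basisVec_left, map_sum, Complex.conj_ofReal]
  congr 2
  · refine Finset.sum_congr rfl fun w _ => ?_
    rw [inner_smul_left, inner_basisVec_left, Complex.conj_ofReal]
  · refine Finset.sum_congr rfl fun w _ => ?_
    rw [map_pow, Complex.conj_ofReal]

/-- On siblings a vector in the range is proportional to the weights, and the coefficients of
`wanderVec` are chosen so that its pairing with the weights cancels. -/
lemma inner_wanderVec_weightedShift (hG : IsDirectedTree G) (v : V) (f : Ell2 V) :
    inner ℂ (wanderVec G lam henc v) (weightedShift G lam hb f) = 0 := by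
  by_cases hr : IsRoot G v
  · rw [inner_wanderVec_of_isRoot hr, weightedShift_coord_of_isRoot f hr]
  · rw [inner_wanderVec hr, weightedShift_coord_of_adj hG f (adj_par_of_not_isRoot hr)]
    have : ∑ w ∈ precSibs G henc v, (lam w : ℂ) * weightedShift G lam hb f w =
        (∑ w ∈ precSibs G henc v, (lam w : ℂ) ^ 2) * f (par G v) := by
      rw [Finset.sum_mul]
      refine Finset.sum_congr rfl fun w hw => ?_
      rw [weightedShift_coord_of_adj hG f (mem_precSibs.1 hw).2]
      ring
    rw [this]
    ring

open Classical in
lemma wanderVec_coord {v : V} (h : ¬ IsRoot G v) (x : V) :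
    wanderVec G lam henc v x =
      (if x ∈ precSibs G henc v then (lam v : ℂ) * lam x else 0) -
        if x = v then ∑ w ∈ precSibs G henc v, (lam w : ℂ) ^ 2 else 0 := by
  rw [← inner_basisVec_left, wanderVec, if_neg h, inner_sub_right, inner_smul_right,
    inner_smul_right, inner_sum]
  simp only [inner_smul_right, inner_basisVec_left, basisVec_apply]
  congr 1
  · rw [← mul_ite_zero]
    simp
  · rw [mul_ite, mul_one, mul_zero]

lemma wanderVec_coord_of_notAdj (hr : ¬ IsRoot G v) {x : V} (hx : ¬ G.Adj (par G v) x) :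
    wanderVec G lam henc v x = 0 := by
  classical
  rw [wanderVec_coord hr, if_neg (fun h => hx (mem_precSibs.1 h).2), if_neg, sub_zero]
  rintro rfl
  exact hx (adj_par_of_not_isRoot hr)

/-- If `v` precedes its sibling `w`, then on the support of the vector of `v` the vector of `w` is
proportional to the weights, to which the former is orthogonal. Vertices with different parents, or
a root and a non-root, give disjoint supports. -/
lemma inner_wanderVec_of_ne (hG : IsDirectedTree G) {v w : V} (hne : v ≠ w) :
    inner ℂ (wanderVec G lam henc v) (wanderVec G lam henc w) = 0 := by
  classical
  wlog hlt : enc v < enc w generalizing v w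
  · rw [← inner_conj_symm, this hne.symm, map_zero]
    exact lt_of_le_of_ne (not_lt.1 hlt) fun h => hne (henc h).symm
  by_cases hrv : IsRoot G v
  · by_cases hrw : IsRoot G w
    · exact absurd (hG.isRoot_unique hrv hrw) hne
    · rw [inner_wanderVec_of_isRoot hrv, wanderVec_coord_of_notAdj hrw (hrv _)]
  by_cases hrw : IsRoot G w
  · rw [← inner_conj_symm, inner_wanderVec_of_isRoot hrw, wanderVec_coord_of_notAdj hrv (hrw _),
      map_zero]
  have hv := adj_par_of_not_isRoot hrv
  rw [inner_wanderVec hrv]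
  by_cases hp : par G v = par G w
  · have h1 : ∀ x, G.Adj (par G v) x → enc x < enc w →
        wanderVec G lam henc w x = (lam w : ℂ) * lam x := by
      intro x hx hxw
      rw [wanderVec_coord hrw, if_pos (mem_precSibs.2 ⟨hxw, hp ▸ hx⟩), if_neg, sub_zero]
      rintro rfl
      exact hxw.false
    have h2 : ∑ x ∈ precSibs G henc v, (lam x : ℂ) * wanderVec G lam henc w x =
        (∑ x ∈ precSibs G henc v, (lam x : ℂ) ^ 2) * lam w := by
      rw [Finset.sum_mul]
      refine Finset.sum_congr rfl fun x hx => ?_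
      obtain ⟨h3, h4⟩ := mem_precSibs.1 hx
      rw [h1 x h4 (h3.trans hlt)]
      ring
    rw [h2, h1 v hv hlt]
    ring
  · have h1 : ∀ x, G.Adj (par G v) x → wanderVec G lam henc w x = 0 := fun x hx =>
      wanderVec_coord_of_notAdj hrw fun hx' => hp (hG.parent_unique _ _ _ hx hx')
    rw [h1 v hv, Finset.sum_eq_zero fun x hx => by rw [h1 x (mem_precSibs.1 hx).2, mul_zero]]
    simp

variable (hpos : ∀ u v, G.Adj u v → 0 < lam v)
include hpos

/-- For a first child the sum is empty and its `wanderVec` is zero; this is why first children are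
left out of the basis. -/
lemma sum_precSibs_ne_zero {v : V} (hr : ¬ IsRoot G v) (hv : ¬ IsFirstChild G enc v) :
    ∑ w ∈ precSibs G henc v, (lam w : ℂ) ^ 2 ≠ 0 := by
  rw [IsFirstChild, not_and] at hv
  have hv := hv hr
  push Not at hv
  obtain ⟨w, hw, hlt⟩ := hv
  have : 0 < ∑ w ∈ precSibs G henc v, lam w ^ 2 :=
    Finset.sum_pos (fun x hx => pow_pos (hpos _ _ (mem_precSibs.1 hx).2) 2)
      ⟨w, mem_precSibs.2 ⟨hlt, hw⟩⟩
  exact_mod_cast this.ne'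

lemma wanderVec_ne_zero {v : V} (hv : ¬ IsFirstChild G enc v) : wanderVec G lam henc v ≠ 0 := by
  classical
  intro h
  by_cases hr : IsRoot G v
  · have h1 := norm_basisVec v
    rw [wanderVec, if_pos hr] at h
    rw [h, norm_zero] at h1
    exact zero_ne_one h1
  · have h1 := wanderVec_coord (lam := lam) (henc := henc) hr v
    rw [h, if_neg (fun h => (mem_precSibs.1 h).1.false), if_pos rfl, zero_sub] at h1
    exact neg_ne_zero.2 (sum_precSibs_ne_zero hpos hr hv) h1.symm

variable (hG : IsDirectedTree G) (hiso : ∀ f, ‖weightedShift G lam hb f‖ = ‖f‖)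
include hG hiso

omit hpos in
lemma hasSum_sq_of_isometry (u : V) : HasSum (fun v : chi G u => (lam v : ℂ) ^ 2) 1 := by
  have h := inner_weightedShift_basisVec (hb := hb) hG u (weightedShift G lam hb (basisVec u))
  rw [inner_isometry hiso, inner_basisVec_left, basisVec_apply, if_pos rfl] at h
  convert h using 1
  funext v
  rw [weightedShift_basisVec_coord hG, if_pos (show G.Adj u v from v.2), sq]

/-- A summable family of nonzero terms has a countable index set, so each vertex has countably many
children. -/
lemma countable_of_isometry : Countable V := by
  refine hG.countable fun u => ?_
  have h := (hasSum_sq_of_isometry hG hiso u).summable.countable_support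
  have h' : (Function.support fun v : chi G u => (lam v : ℂ) ^ 2) = Set.univ := by
    rw [Set.eq_univ_iff_forall]
    intro v
    have := (hpos u v v.2).ne'
    rw [Function.mem_support]
    exact pow_ne_zero 2 (by exact_mod_cast this)
  rw [h', Set.countable_univ_iff] at h
  exact Set.countable_coe_iff.1 h

omit hpos in
lemma isLeafless_of_isometry : IsLeafless G := by
  intro u
  by_contra h
  rw [Set.not_nonempty_iff_eq_empty] at h
  have he : IsEmpty (chi G u) := Set.isEmpty_coe_sort.2 h
  exact zero_ne_one (hasSum_empty.unique (hasSum_sq_of_isometry hG hiso u))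

lemma exists_weightedShift_eq {f : Ell2 V}
    (hf : ∀ v, ¬ IsFirstChild G enc v → inner ℂ (wanderVec G lam henc v) f = 0) :
    ∃ g, weightedShift G lam hb g = f := by
  choose fst hfst hfst' using
    exists_isFirstChild hG (isLeafless_of_isometry hG hiso) enc
  -- The first child fixes the ratio of `f` to the weights; each orthogonality relation then
  -- determines `f v` from the earlier siblings, so the ratio is the same on all children of `u`.
  set c : V → ℂ := fun u => f (fst u) / lam (fst u) with hc
  have hne : ∀ {u v}, G.Adj u v → (lam v : ℂ) ≠ 0 := fun h => by
    exact_mod_cast (hpos _ _ h).ne'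
  have key : ∀ (n : ℕ) u v, G.Adj u v → enc v = n → f v = lam v * c u := by
    intro n
    induction n using Nat.strong_induction_on with
    | _ n ih =>
      intro u v huv hn
      by_cases hv : IsFirstChild G enc v
      · have : v = fst u := by
          refine henc (le_antisymm (hv.2 _ ?_) ((hfst' u).2 _ ?_))
          · rw [hG.par_eq huv]; exact hfst u
          · rw [hG.par_eq (hfst u)]; exact huv
        rw [hc, this, mul_div_cancel₀ _ (hne (hfst u))]
      · have hr : ¬ IsRoot G v := not_isRoot_iff.2 ⟨u, huv⟩
        have h1 := hf v hv
        have h2 : ∑ w ∈ precSibs G henc v, (lam w : ℂ) * f w =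
            (∑ w ∈ precSibs G henc v, (lam w : ℂ) ^ 2) * c u := by
          rw [Finset.sum_mul]
          refine Finset.sum_congr rfl fun w hw => ?_
          obtain ⟨h3, h4⟩ := mem_precSibs.1 hw
          rw [hG.par_eq huv] at h4
          rw [ih (enc w) (hn ▸ h3) u w h4 rfl]
          ring
        rw [inner_wanderVec hr, h2, mul_left_comm, ← mul_sub] at h1
        exact (sub_eq_zero.1
          ((mul_eq_zero.1 h1).resolve_left (sum_precSibs_ne_zero hpos hr hv))).symm
  -- The preimage has to be `c`. Taking `S* f` instead makes square summability automatic, and its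
  -- value at `u` is `c u * ∑ lam v ^ 2 = c u`.
  refine ⟨ContinuousLinearMap.adjoint (weightedShift G lam hb) f, ?_⟩
  ext v
  by_cases hr : IsRoot G v
  · rw [weightedShift_coord_of_isRoot _ hr,
      ← inner_wanderVec_of_isRoot (lam := lam) (henc := henc) hr f, hf v fun h => h.1 hr]
  · have hp := adj_par_of_not_isRoot hr
    rw [weightedShift_coord_of_adj hG _ hp, key _ _ v hp rfl]
    congr 1
    rw [← inner_basisVec_left, ContinuousLinearMap.adjoint_inner_right]
    refine (inner_weightedShift_basisVec hG (par G v) f).unique ?_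
    have h1 := (hasSum_sq_of_isometry hG hiso (par G v)).mul_right (c (par G v))
    rw [one_mul] at h1
    refine Eq.subst (motive := fun F => HasSum F _) (funext fun w => Eq.symm ?_) h1
    rw [key _ _ w.1 w.2 rfl]
    ring

open Classical in
/-- The orthocomplement of the range of an isometric weighted shift on a directed tree. -/
theorem exists_wandering_family : ∃ z : IndexSet (branchingIndex G + if HasRoot G then 1 else 0) →
    Ell2 V, Orthonormal ℂ z ∧ (∀ i f, inner ℂ (z i) (weightedShift G lam hb f) = 0) ∧
      ∀ f, (∀ i, inner ℂ (z i) f = 0) → ∃ g, weightedShift G lam hb g = f := by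
  have hcount := countable_of_isometry hpos hG hiso
  obtain ⟨enc, henc⟩ := exists_injective_nat V
  obtain ⟨e⟩ := exists_equiv_indexSet
    (card_not_isFirstChild hG (isLeafless_of_isometry hG hiso) henc)
  let y : {v // ¬ IsFirstChild G enc v} → Ell2 V := fun v =>
    (((‖wanderVec G lam henc v.1‖⁻¹ : ℝ)) : ℂ) • wanderVec G lam henc v.1
  have hn : ∀ v : {v // ¬ IsFirstChild G enc v}, ‖wanderVec G lam henc v.1‖ ≠ 0 := fun v =>
    norm_ne_zero_iff.2 (wanderVec_ne_zero hpos v.2)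
  have hy : Orthonormal ℂ y := by
    refine ⟨fun v => ?_, fun v w h => ?_⟩
    · simp only [y, norm_smul, Complex.norm_real, norm_inv, norm_norm]
      exact inv_mul_cancel₀ (hn v)
    · have : v.1 ≠ w.1 := fun h' => h (Subtype.ext h')
      change inner ℂ (y v) (y w) = 0
      simp only [y, inner_smul_left, inner_smul_right, inner_wanderVec_of_ne hG this, mul_zero]
  refine ⟨y ∘ e.symm, hy.comp _ e.symm.injective, fun i f => ?_, fun f hf => ?_⟩
  · simp only [Function.comp_apply, y, inner_smul_left, inner_wanderVec_weightedShift hG, mul_zero]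
  · refine exists_weightedShift_eq (henc := henc) hpos hG hiso fun v hv => ?_
    have h1 := hf (e ⟨v, hv⟩)
    simp only [Function.comp_apply, Equiv.symm_apply_apply, y, inner_smul_left] at h1
    refine (mul_eq_zero.1 h1).resolve_left ?_
    rw [Complex.conj_ofReal]
    exact_mod_cast inv_ne_zero (hn ⟨v, hv⟩)

end IsometricShift

/-- Finite products decrease as factors are added and are bounded below by zero. Convergence ensures
that the infinite products `∏'` used for paths are genuine limits and not the default value `1`. -/
lemma multipliable_of_mem_unitInterval {a : ℕ → ℝ} (h0 : ∀ n, 0 ≤ a n) (h1 : ∀ n, a n ≤ 1) :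
    Multipliable a := by
  refine ⟨⨅ s : Finset ℕ, ∏ n ∈ s, a n, ?_⟩
  refine tendsto_atTop_ciInf (fun s t hst => ?_) ⟨0, ?_⟩
  · classical
    rw [← Finset.prod_sdiff hst]
    exact mul_le_of_le_one_left (Finset.prod_nonneg fun i _ => h0 i)
      (Finset.prod_le_one (fun i _ => h0 i) fun i _ => h1 i)
  · rintro _ ⟨s, rfl⟩
    exact Finset.prod_nonneg fun i _ => h0 i

/-! ### Trees with a root: no unitary part. -/

section Rooted

variable {V : Type*} {G : Digraph V} {lam : V → ℝ} {hb : BoundedWeights G lam}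

/-- If `v` lies `n` levels below the root, the path product for the power `n + 1` contains the zero
weight of the root. -/
lemma eq_zero_of_mem_inPowRanges_of_hasRoot (hG : IsDirectedTree G) (hr : HasRoot G) {f : Ell2 V}
    (hf : f ∈ inPowRanges (weightedShift G lam hb)) : f = 0 := by
  obtain ⟨r, hr⟩ := hr
  ext v
  obtain ⟨m, n, h⟩ := hG.exists_iterate_par_eq r v
  rw [iterate_par_of_isRoot hr] at h
  obtain ⟨g, rfl⟩ := hf (n + 1)
  rw [weightedShift_pow_coord, Finset.prod_range_succ, ← h, effWeight_of_isRoot hr]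
  simp

end Rooted

/-! ### Trees without a root: path products and the unitary part. -/

section Rootless

variable {V : Type*} {G : Digraph V} {lam : V → ℝ} {hb : BoundedWeights G lam}

lemma effWeight_of_not_hasRoot (hr : ¬ HasRoot G) (v : V) : effWeight G lam v = lam v :=
  effWeight_of_not_isRoot fun h => hr ⟨v, h⟩

lemma exists_common_ancestor (t : Finset V)
    (ht : ∀ v ∈ t, ∀ w ∈ t, ∃ n : ℕ, (par G)^[n] v = (par G)^[n] w) (hne : t.Nonempty) :
    ∃ (n : ℕ) (u : V), ∀ v ∈ t, (par G)^[n] v = u := by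
  obtain ⟨w, hw⟩ := hne
  have : ∀ v, ∃ n : ℕ, v ∈ t → (par G)^[n] v = (par G)^[n] w := fun v => by
    by_cases hv : v ∈ t
    · obtain ⟨n, hn⟩ := ht v hv w hw
      exact ⟨n, fun _ => hn⟩
    · exact ⟨0, fun h => absurd h hv⟩
  choose n hn using this
  refine ⟨t.sup n, (par G)^[t.sup n] w, fun v hv => ?_⟩
  obtain ⟨d, hd⟩ := Nat.exists_eq_add_of_le' (Finset.le_sup (f := n) hv)
  rw [hd, Function.iterate_add_apply, hn v hv, ← Function.iterate_add_apply]

lemma weight_pos_of_not_hasRoot (hr : ¬ HasRoot G)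
    (hpos : ∀ u v, G.Adj u v → 0 < lam v) (v : V) : 0 < lam v :=
  hpos _ _ (adj_par_of_not_isRoot fun h => hr ⟨v, h⟩)

/-- The product of the squared weights along the path from `v` upwards. -/
noncomputable def pathProd (G : Digraph V) (lam : V → ℝ) (v : V) : ℝ :=
  ∏' j : ℕ, lam ((par G)^[j] v) ^ 2

section
variable (hG : IsDirectedTree G) (hr : ¬ HasRoot G)
  (hiso : ∀ f, ‖weightedShift G lam hb f‖ = ‖f‖)
include hG hr hiso

lemma sq_weight_le_one (v : V) : lam v ^ 2 ≤ 1 := by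
  have h := norm_coord_le (weightedShift G lam hb (basisVec (par G v))) v
  rw [hiso, norm_basisVec, weightedShift_coord_of_adj hG _
    (adj_par_of_not_isRoot fun h => hr ⟨v, h⟩), basisVec_apply, if_pos rfl, mul_one,
    Complex.norm_real, Real.norm_eq_abs] at h
  exact (sq_le_one_iff_abs_le_one _).2 h

lemma tendsto_pathProd (v : V) :
    Tendsto (fun n => ∏ j ∈ Finset.range n, lam ((par G)^[j] v) ^ 2) atTop
      (𝓝 (pathProd G lam v)) :=
  (multipliable_of_mem_unitInterval (fun _ => sq_nonneg _)
    fun _ => sq_weight_le_one hG hr hiso _).hasProd.tendsto_prod_nat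

lemma pathProd_nonneg (v : V) : 0 ≤ pathProd G lam v :=
  ge_of_tendsto' (tendsto_pathProd hG hr hiso v) fun _ => Finset.prod_nonneg fun _ _ => sq_nonneg _

lemma pathProd_le_one (v : V) : pathProd G lam v ≤ 1 :=
  le_of_tendsto' (tendsto_pathProd hG hr hiso v) fun _ =>
    Finset.prod_le_one (fun _ _ => sq_nonneg _) fun _ _ => sq_weight_le_one hG hr hiso _

lemma pathProd_eq_mul (v : V) : pathProd G lam v = lam v ^ 2 * pathProd G lam (par G v) := by
  have h1 := (tendsto_add_atTop_iff_nat 1).2 (tendsto_pathProd hG hr hiso v)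
  refine tendsto_nhds_unique h1 (((tendsto_pathProd hG hr hiso (par G v)).const_mul
    (lam v ^ 2)).congr fun n => ?_)
  rw [Finset.prod_range_succ', mul_comm]
  rfl

lemma pathProd_eq_prod_mul (n : ℕ) (v : V) : pathProd G lam v =
    (∏ j ∈ Finset.range n, lam ((par G)^[j] v) ^ 2) * pathProd G lam ((par G)^[n] v) := by
  induction n with
  | zero => simp
  | succ n ih =>
    rw [ih, Finset.prod_range_succ, pathProd_eq_mul hG hr hiso ((par G)^[n] v),
      Function.iterate_succ_apply', mul_assoc]

/-- Without a unitary part: the path products vanish. -/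
lemma eq_zero_of_mem_inPowRanges (hP : ∀ v, pathProd G lam v = 0) {f : Ell2 V}
    (hf : f ∈ inPowRanges (weightedShift G lam hb)) : f = 0 := by
  ext v
  -- If `f = S^n g`, then `f v` is a partial path product of weights times a coordinate of `g`, and
  -- `‖g‖ = ‖f‖`.
  have h1 : ∀ n, ‖f v‖ ^ 2 ≤ (∏ j ∈ Finset.range n, lam ((par G)^[j] v) ^ 2) * ‖f‖ ^ 2 := by
    intro n
    obtain ⟨g, rfl⟩ := hf n
    rw [weightedShift_pow_coord, norm_mul, mul_pow, Complex.norm_real, Real.norm_eq_abs, sq_abs,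
      Finset.prod_congr rfl fun j _ => effWeight_of_not_hasRoot hr _, Finset.prod_pow,
      norm_isometry_pow hiso]
    exact mul_le_mul_of_nonneg_left (pow_le_pow_left₀ (norm_nonneg _) (norm_coord_le g _) 2)
      (sq_nonneg _)
  have h2 := ge_of_tendsto' ((tendsto_pathProd hG hr hiso v).mul_const (‖f‖ ^ 2)) h1
  rw [hP, zero_mul] at h2
  exact norm_eq_zero.1 ((pow_eq_zero_iff two_ne_zero).1 (le_antisymm h2 (by positivity)))

/-- If `u` is a common `n`-th ancestor of `t`, dropping the factors beyond `u`, which are at most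
one, bounds the sum by `‖S^n e_u‖ ^ 2 = 1`. -/
lemma sum_pathProd_le_one (t : Finset V)
    (ht : ∀ v ∈ t, ∀ w ∈ t, ∃ n : ℕ, (par G)^[n] v = (par G)^[n] w) :
    ∑ v ∈ t, pathProd G lam v ≤ 1 := by
  rcases t.eq_empty_or_nonempty with rfl | hne
  · simp
  obtain ⟨n, u, hu⟩ := exists_common_ancestor t ht hne
  have h1 := hasSum_norm_sq ((weightedShift G lam hb ^ n) (basisVec u))
  rw [norm_isometry_pow hiso, norm_basisVec, one_pow] at h1
  refine le_trans (Finset.sum_le_sum fun v hv => ?_) (sum_le_hasSum t (fun _ _ => by positivity) h1)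
  rw [weightedShift_pow_coord, basisVec_apply, if_pos (hu v hv), mul_one, Complex.norm_real,
    Real.norm_eq_abs, sq_abs, Finset.prod_congr rfl fun j _ => effWeight_of_not_hasRoot hr _,
    ← Finset.prod_pow, pathProd_eq_prod_mul hG hr hiso n v]
  exact mul_le_of_le_one_right (Finset.prod_nonneg fun _ _ => sq_nonneg _)
    (pathProd_le_one hG hr hiso _)

variable (hpos : ∀ u v, G.Adj u v → 0 < lam v)
include hpos

/-- The product at `v` is that at its parent times a positive number, so vanishing propagates along
edges in both directions. -/
lemma pathProd_pos {u : V} (hu : pathProd G lam u ≠ 0) (v : V) : 0 < pathProd G lam v := by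
  refine (pathProd_nonneg hG hr hiso v).lt_of_ne' ?_
  refine hG.forall_of_iff_par (p := fun v => pathProd G lam v ≠ 0) (fun v => ?_) hu v
  rw [pathProd_eq_mul hG hr hiso v]
  simp [(weight_pos_of_not_hasRoot hr hpos v).ne']

/-- The unitary part: if a path product does not vanish, there is a bilateral orthonormal sequence
that is shifted by the weighted shift and spans the vectors in the range of every power. -/
lemma exists_bilateral_sequence {u : V} (hu : pathProd G lam u ≠ 0) :
    ∃ x : ℤ → Ell2 V, Orthonormal ℂ x ∧ (∀ m, weightedShift G lam hb (x m) = x (m + 1)) ∧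
      ∀ f ∈ inPowRanges (weightedShift G lam hb), (∀ m, inner ℂ (x m) f = 0) → f = 0 := by
  obtain ⟨ht, ht1, ht2⟩ := hG.exists_height hr
  have hP := pathProd_pos hG hr hiso hpos hu
  -- By `pathProd_eq_mul` the square roots of the path products satisfy exactly the relation that
  -- lets the shift carry level `m` to level `m + 1`.
  let yf : ℤ → V → ℂ := fun m v => if ht v = m then ((√(pathProd G lam v) : ℝ) : ℂ) else 0
  have hyn : ∀ m v, ‖yf m v‖ ^ 2 = if ht v = m then pathProd G lam v else 0 := by
    intro m v
    simp only [yf]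
    split_ifs
    · rw [Complex.norm_real, Real.norm_eq_abs, sq_abs, Real.sq_sqrt (hP v).le]
    · simp
  have hmem : ∀ m, Memℓp (yf m) 2 := by
    intro m
    refine memℓp_gen' (C := 1) fun s => ?_
    have h2 : (2 : ℝ≥0∞).toReal = (2 : ℕ) := by norm_num
    simp only [h2, Real.rpow_natCast, hyn]
    rw [← Finset.sum_filter]
    refine sum_pathProd_le_one hG hr hiso _ fun v hv w hw => ht2 v w ?_
    rw [(Finset.mem_filter.1 hv).2, (Finset.mem_filter.1 hw).2]
  let y : ℤ → Ell2 V := fun m => ⟨yf m, hmem m⟩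
  have hyv : ∀ m v, y m v = yf m v := fun _ _ => rfl
  have hyU : ∀ m, weightedShift G lam hb (y m) = y (m + 1) := by
    intro m
    ext v
    rw [weightedShift_coord, hyv, hyv, effWeight_of_not_hasRoot hr]
    simp only [yf]
    by_cases h : ht (par G v) = m
    · rw [if_pos h, if_pos (by rw [ht1, h]), pathProd_eq_mul hG hr hiso v,
        Real.sqrt_mul (sq_nonneg _),
        Real.sqrt_sq (weight_pos_of_not_hasRoot hr hpos v).le]
      push_cast
      rfl
    · rw [if_neg h, if_neg (by rw [ht1]; omega), mul_zero]
  have hnorm : ∀ m, ‖y m‖ = ‖y 0‖ := by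
    intro m
    induction m using Int.induction_on with
    | zero => rfl
    | succ i ih => rw [← hyU, hiso, ih]
    | pred i ih => rw [← ih, ← hiso, hyU, sub_add_cancel]
  have hne : ‖y 0‖ ≠ 0 := by
    rw [← hnorm (ht u), norm_ne_zero_iff]
    intro h
    have h1 := hyv (ht u) u
    rw [h] at h1
    rw [lp.coeFn_zero, Pi.zero_apply] at h1
    simp only [yf, if_pos] at h1
    have h2 : √(pathProd G lam u) = 0 := by exact_mod_cast h1.symm
    exact (Real.sqrt_pos.2 (hP u)).ne' h2
  refine ⟨fun m => ((‖y 0‖⁻¹ : ℝ) : ℂ) • y m, ⟨fun m => ?_, fun m n hmn => ?_⟩, fun m => ?_,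
    fun f hf hx => ?_⟩
  · rw [norm_smul, Complex.norm_real, norm_inv, norm_norm, hnorm m, inv_mul_cancel₀ hne]
  · change inner ℂ (((‖y 0‖⁻¹ : ℝ) : ℂ) • y m) (((‖y 0‖⁻¹ : ℝ) : ℂ) • y n) = 0
    have : inner ℂ (y m) (y n) = 0 := by
      refine (lp.hasSum_inner (𝕜 := ℂ) (y m) (y n)).unique ?_
      refine Eq.subst (motive := fun F => HasSum F _) (funext fun v => Eq.symm ?_) hasSum_zero
      rw [hyv, hyv]
      simp only [yf]
      by_cases h : ht v = m
      · rw [if_neg (c := ht v = n) (by omega), inner_zero_right]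
      · rw [if_neg h, inner_zero_left]
    rw [inner_smul_left, inner_smul_right, this, mul_zero, mul_zero]
  · rw [map_smul, hyU]
  · ext v
    have hsq : ∀ w, ((√(pathProd G lam w) : ℝ) : ℂ) ≠ 0 := fun w => by
      exact_mod_cast (Real.sqrt_pos.2 (hP w)).ne'
    -- Two vertices of one level share an `n`-th ancestor, and `f = S^n g`, so both coordinates are
    -- path products times the same value of `g`. Thus `f` is a multiple of `y (ht v)` on that
    -- level.
    have hprop : ∀ w, ht w = ht v →
        f w = √(pathProd G lam w) * (f v / √(pathProd G lam v)) := by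
      intro w hw
      obtain ⟨n, hn⟩ := ht2 w v hw
      obtain ⟨g, rfl⟩ := hf n
      have key : ∀ w, √(pathProd G lam w) =
          (∏ j ∈ Finset.range n, effWeight G lam ((par G)^[j] w)) *
            √(pathProd G lam ((par G)^[n] w)) := by
        intro w
        rw [pathProd_eq_prod_mul hG hr hiso n w, Finset.prod_pow, Real.sqrt_mul (sq_nonneg _),
          Real.sqrt_sq, Finset.prod_congr rfl fun j _ => effWeight_of_not_hasRoot hr _]
        exact Finset.prod_nonneg fun j _ => (weight_pos_of_not_hasRoot hr hpos _).le
      have h1 := hsq v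
      rw [mul_div_assoc', eq_div_iff h1, weightedShift_pow_coord, weightedShift_pow_coord, key w,
        key v, hn]
      push_cast
      ring
    have h1 : inner ℂ (y (ht v)) f = 0 := by
      have := hx (ht v)
      rw [inner_smul_left] at this
      refine (mul_eq_zero.1 this).resolve_left ?_
      rw [Complex.conj_ofReal]
      exact_mod_cast inv_ne_zero hne
    have h2 : HasSum (fun w => ((‖y (ht v) w‖ ^ 2 : ℝ) : ℂ) * (f v / √(pathProd G lam v)))
        (((‖y (ht v)‖ ^ 2 : ℝ) : ℂ) * (f v / √(pathProd G lam v))) :=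
      (Complex.hasSum_ofReal.2 (hasSum_norm_sq (y (ht v)))).mul_right _
    have h3 := lp.hasSum_inner (𝕜 := ℂ) (y (ht v)) f
    rw [h1] at h3
    have h4 := h3.unique (Eq.subst (motive := fun F => HasSum F _) (funext fun w => ?_) h2)
    · rw [hnorm] at h4
      have h5 : ((‖y 0‖ ^ 2 : ℝ) : ℂ) ≠ 0 := by exact_mod_cast pow_ne_zero 2 hne
      have h6 := (mul_eq_zero.1 h4.symm).resolve_left h5
      exact (div_eq_zero_iff.1 h6).resolve_right (hsq v)
    · rw [hyv, hyn]
      by_cases h : ht w = ht v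
      · rw [if_pos h, hprop w h, RCLike.inner_apply]
        simp only [yf, if_pos h]
        have e : (starRingEnd ℂ) ((√(pathProd G lam w) : ℝ) : ℂ) = (√(pathProd G lam w) : ℝ) :=
          Complex.conj_ofReal _
        have e2 : ((√(pathProd G lam w) : ℝ) : ℂ) * ((√(pathProd G lam w) : ℝ) : ℂ) =
            (pathProd G lam w : ℂ) := by
          rw [← Complex.ofReal_mul, Real.mul_self_sqrt (hP w).le]
        rw [e, ← e2]
        ring
      · rw [if_neg h]
        simp [yf, h]

/-- If some product is nonzero, the unit vector `x 0 = S^n (x (-n))` lies in the range of every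
power. -/
lemma isCNU_weightedShift_iff :
    IsCNU (weightedShift G lam hb) ↔ ∀ v, pathProd G lam v = 0 := by
  rw [isCNU_iff_of_isometry hiso]
  constructor
  · intro h v
    by_contra hv
    obtain ⟨x, hx, hxU, -⟩ := exists_bilateral_sequence hG hr hiso hpos hv
    have hx0 : x 0 ∈ inPowRanges (weightedShift G lam hb) := by
      have : ∀ (n : ℕ) m, (weightedShift G lam hb ^ n) (x m) = x (m + n) := by
        intro n
        induction n with
        | zero => intro m; simp
        | succ n ih =>
          intro m
          rw [pow_succ]
          change (weightedShift G lam hb ^ n) (weightedShift G lam hb (x m)) = _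
          rw [hxU, ih]
          congr 1
          push_cast
          ring
      intro n
      exact ⟨x (-n), by rw [this, neg_add_cancel]⟩
    have h1 := hx.1 0
    rw [h _ hx0, norm_zero] at h1
    exact zero_ne_one h1
  · intro h f hf
    exact eq_zero_of_mem_inPowRanges hG hr hiso h hf

end

end Rootless

/-! ### Complete non-unitarity under unitary equivalence. -/

section Transfer

variable {H : Type*} [NormedAddCommGroup H] [InnerProductSpace ℂ H] [CompleteSpace H]
  {K : Type*} [NormedAddCommGroup K] [InnerProductSpace ℂ K] [CompleteSpace K]

lemma isCNU_congr {U : H →L[ℂ] H} {U' : K →L[ℂ] K} (hU : ∀ x, ‖U x‖ = ‖x‖) (J : K ≃ₗᵢ[ℂ] H)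
    (hJ : ∀ x, U (J x) = J (U' x)) : IsCNU U ↔ IsCNU U' := by
  have hU' : ∀ x, ‖U' x‖ = ‖x‖ := fun x => by
    rw [← J.norm_map, ← hJ, hU, J.norm_map]
  have hpow : ∀ (n : ℕ) x, (U ^ n) (J x) = J ((U' ^ n) x) := by
    intro n
    induction n with
    | zero => intro x; rfl
    | succ n ih =>
      intro x
      rw [pow_succ, pow_succ]
      change (U ^ n) (U (J x)) = J ((U' ^ n) (U' x))
      rw [hJ, ih]
  have hmem : ∀ x, J x ∈ inPowRanges U ↔ x ∈ inPowRanges U' := by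
    intro x
    refine forall_congr' fun n => ?_
    constructor
    · rintro ⟨g, hg⟩
      refine ⟨J.symm g, J.injective ?_⟩
      rw [← hpow, J.apply_symm_apply, hg]
    · rintro ⟨g, rfl⟩
      exact ⟨J g, hpow n g⟩
  rw [isCNU_iff_of_isometry hU, isCNU_iff_of_isometry hU']
  constructor
  · intro h f hf
    have := h (J f) ((hmem f).2 hf)
    rwa [map_eq_zero_iff J J.injective] at this
  · intro h f hf
    have := h (J.symm f) ((hmem _).1 (by rwa [J.apply_symm_apply]))
    rwa [map_eq_zero_iff J.symm J.symm.injective] at this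

end Transfer

end TreeShift

/-! ### The main theorem. -/

theorem mainTheorem1 {V : Type*} (G : Digraph V) (hG : IsDirectedTree G)
    (lam : V → ℝ) (hpos : ∀ u v, G.Adj u v → 0 < lam v) (hb : BoundedWeights G lam)
    (hc : ‖weightedShift G lam hb‖ ≤ 1) (hns : ¬ IsStable (weightedShift G lam hb)) :
    -- `V'` is the set of vertices with `H₀ = ℓ²(V \ V')` and `H₀ᗮ = ℓ²(V')`
    stableSubspace (weightedShift G lam hb) = ell2Sub (coreSet G lam hb)ᶜ ∧
    (stableSubspace (weightedShift G lam hb))ᗮ = ell2Sub (coreSet G lam hb) ∧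
    -- `T'` is a leafless subtree
    IsDirectedTree (coreTree G lam hb) ∧ IsLeafless (coreTree G lam hb) ∧
    -- the numbers `alpha u` are well defined, and positive on `V'` and at the parents of its vertices
    (∀ u, (∀ n, Summable fun v : chiPow G n u =>
        ∏ j ∈ Finset.range n, lam ((par G)^[j] v) ^ 2) ∧
      Tendsto (fun n => alphaSum G lam n u) atTop (𝓝 (alpha G lam u))) ∧
    (∀ v ∈ coreSet G lam hb, 0 < alpha G lam v ∧ par G v ∈ coreSet G lam hb) ∧
    -- `U` is the weighted shift on `T'` with the weights `β`
    (∃ hβ : BoundedWeights (coreTree G lam hb) (coreWeight G lam hb),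
      ∃ J : Ell2 (coreSet G lam hb) ≃ₗᵢ[ℂ] (stableSubspace (weightedShift G lam hb))ᗮ,
        (∀ f, (J f : Ell2 V) = ell2Incl (coreSet G lam hb) f) ∧
        ∀ f, isometricAsymptote (weightedShift G lam hb) hc (J f) =
          J (weightedShift (coreTree G lam hb) (coreWeight G lam hb) hβ f)) ∧
    -- (i)
    (HasRoot G →
      UnitarilyEquivalent
        (isometricAsymptote (weightedShift G lam hb) hc).toContinuousLinearMap
        (unilateralShiftMult (branchingIndex (coreTree G lam hb) + 1))) ∧
    -- the description of the completely non-unitary case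
    (¬ HasRoot G →
      (IsCNU (isometricAsymptote (weightedShift G lam hb) hc).toContinuousLinearMap ↔
        ∃ u, HasSum (fun v : gen (coreTree G lam hb) u =>
          ∏' j : ℕ, coreWeight G lam hb ((par (coreTree G lam hb))^[j] v) ^ 2) 0) ∧
      (IsCNU (isometricAsymptote (weightedShift G lam hb) hc).toContinuousLinearMap ↔
        ∀ u, HasSum (fun v : gen (coreTree G lam hb) u =>
          ∏' j : ℕ, coreWeight G lam hb ((par (coreTree G lam hb))^[j] v) ^ 2) 0)) ∧
    -- (ii)
    (¬ HasRoot G →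
      IsCNU (isometricAsymptote (weightedShift G lam hb) hc).toContinuousLinearMap →
      UnitarilyEquivalent
        (isometricAsymptote (weightedShift G lam hb) hc).toContinuousLinearMap
        (unilateralShiftMult (branchingIndex (coreTree G lam hb)))) ∧
    -- (iii)
    (¬ HasRoot G →
      ¬ IsCNU (isometricAsymptote (weightedShift G lam hb) hc).toContinuousLinearMap →
      UnitarilyEquivalent
        (isometricAsymptote (weightedShift G lam hb) hc).toContinuousLinearMap
        (orthSum bilateralShift.toContinuousLinearMap
          (unilateralShiftMult (branchingIndex (coreTree G lam hb))))) := by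
  classical
  obtain ⟨J, hJ⟩ := exists_coreEquiv hG hc
  have hβ := boundedWeights_coreWeight hG hc
  have hJU := isometricAsymptote_coreEquiv hG hc hpos hβ J hJ
  have hT := coreTree_isDirectedTree hG hc hpos
  have hTpos : ∀ u v, (coreTree G lam hb).Adj u v → 0 < coreWeight G lam hb v := fun u v huv =>
    coreWeight_pos hG hc hpos (not_isRoot_iff.2 ⟨u, huv⟩)
  have hUiso : ∀ x, ‖(isometricAsymptote (weightedShift G lam hb) hc).toContinuousLinearMap x‖ =
      ‖x‖ := fun x => (isometricAsymptote (weightedShift G lam hb) hc).norm_map x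
  have hiso : ∀ f, ‖weightedShift (coreTree G lam hb) (coreWeight G lam hb) hβ f‖ = ‖f‖ :=
    fun f => by rw [← J.norm_map, ← hJU, LinearIsometry.norm_map, J.norm_map]
  -- This is where instability enters: an empty `V'` would make every vector stable. A vertex of
  -- `V'` is needed to place the root of the tree in `V'` and to witness the existential criterion.
  have hne : Nonempty (coreSet G lam hb) := by
    by_contra h
    rw [Set.nonempty_coe_sort, Set.not_nonempty_iff_eq_empty] at h
    refine hns (Submodule.eq_top_iff'.2 fun f => ?_)
    rw [stableSubspace_eq hG hc, mem_ell2Sub, h]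
    simp
  have hequiv : UnitarilyEquivalent
      (isometricAsymptote (weightedShift G lam hb) hc).toContinuousLinearMap
      (weightedShift (coreTree G lam hb) (coreWeight G lam hb) hβ) := by
    refine ⟨J.symm, fun x => ?_⟩
    rw [J.symm_apply_eq, ← hJU, J.apply_symm_apply]
    rfl
  have hcnu := isCNU_congr hUiso J hJU
  have hroot : HasRoot (coreTree G lam hb) ↔ HasRoot G := by
    constructor
    · rintro ⟨r, hr⟩
      exact ⟨r.1, (isRoot_coreTree_iff hG hc hpos r).1 hr⟩
    · rintro ⟨r, hr⟩
      obtain ⟨v⟩ := hne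
      obtain ⟨m, n, h⟩ := hG.exists_iterate_par_eq r v.1
      have hmem : (par G)^[n] v.1 ∈ coreSet G lam hb := by
        clear h
        induction n with
        | zero => exact v.2
        | succ n ih =>
          rw [Function.iterate_succ_apply']
          exact par_mem_coreSet hG hc hpos ih
      rw [← h, iterate_par_of_isRoot hr] at hmem
      exact ⟨⟨r, hmem⟩, (isRoot_coreTree_iff hG hc hpos ⟨r, hmem⟩).2 hr⟩
  obtain ⟨z, hz, hzU, hran⟩ := exists_wandering_family hTpos hT hiso
  refine ⟨stableSubspace_eq hG hc, stableSubspace_orthogonal_eq hG hc, hT,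
    coreTree_isLeafless hG hc,
    fun u => ⟨fun n => (hasSum_alphaSum (hb := hb) hG n u).summable, tendsto_alphaSum hG hc u⟩,
    fun v hv => ⟨(mem_coreSet_iff hG hc v).1 hv, par_mem_coreSet hG hc hpos hv⟩,
    ⟨hβ, J, hJ, hJU⟩, fun hr => ?_, fun hr => ?_, fun hr hU => ?_, fun hr hU => ?_⟩
  · refine hequiv.trans ?_
    have hn : (branchingIndex (coreTree G lam hb) + if HasRoot (coreTree G lam hb) then 1 else 0) =
        branchingIndex (coreTree G lam hb) + 1 := by rw [if_pos (hroot.2 hr)]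
    exact unitarilyEquivalent_unilateralShiftMult hiso hz hzU hran
      (Equiv.subtypeEquivRight fun i => by rw [hn])
      fun f hf => eq_zero_of_mem_inPowRanges_of_hasRoot hT (hroot.2 hr) hf
  · have hr' := mt hroot.1 hr
    have hzero : ∀ u, HasSum (fun v : gen (coreTree G lam hb) u =>
        ∏' j : ℕ, coreWeight G lam hb ((par (coreTree G lam hb))^[j] v) ^ 2) 0 ↔
        ∀ v ∈ gen (coreTree G lam hb) u,
          pathProd (coreTree G lam hb) (coreWeight G lam hb) v = 0 := by
      intro u
      change HasSum (fun v : gen (coreTree G lam hb) u =>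
        pathProd (coreTree G lam hb) (coreWeight G lam hb) v.1) 0 ↔ _
      rw [hasSum_zero_iff_of_nonneg fun v : gen (coreTree G lam hb) u =>
        pathProd_nonneg hT hr' hiso v.1, funext_iff]
      exact Subtype.forall
    rw [hcnu, isCNU_weightedShift_iff hT hr' hiso hTpos]
    simp only [hzero]
    refine ⟨⟨fun h => ?_, fun ⟨u, hu⟩ v => ?_⟩, fun h u v _ => h v,
      fun h v => h v v (mem_gen_self v)⟩
    · obtain ⟨u⟩ := hne
      exact ⟨u, fun v _ => h v⟩
    -- Since `u` belongs to its own generation, one vanishing sum makes the product at `u` zero,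
    -- hence all of them.
    · by_contra hv
      exact (pathProd_pos hT hr' hiso hTpos hv u).ne' (hu u (mem_gen_self u))
  · refine hequiv.trans ?_
    have hn : (branchingIndex (coreTree G lam hb) + if HasRoot (coreTree G lam hb) then 1 else 0) =
        branchingIndex (coreTree G lam hb) := by rw [if_neg (mt hroot.1 hr), add_zero]
    exact unitarilyEquivalent_unilateralShiftMult hiso hz hzU hran
      (Equiv.subtypeEquivRight fun i => by rw [hn])
      ((isCNU_iff_of_isometry hiso).1 (hcnu.1 hU))
  · refine hequiv.trans ?_
    have hr' := mt hroot.1 hr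
    have hn : (branchingIndex (coreTree G lam hb) + if HasRoot (coreTree G lam hb) then 1 else 0) =
        branchingIndex (coreTree G lam hb) := by rw [if_neg hr', add_zero]
    rw [hcnu, isCNU_weightedShift_iff hT hr' hiso hTpos] at hU
    push Not at hU
    obtain ⟨u, hu⟩ := hU
    obtain ⟨x, hx, hxU, hcompl⟩ := exists_bilateral_sequence hT hr' hiso hTpos hu
    exact unitarilyEquivalent_orthSum hiso hz hzU hran
      (Equiv.subtypeEquivRight fun i => by rw [hn]) hx hxU hcompl
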